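/- Let $d\ge 3$ and let $$M=\{(u,v)\in\mathbb R^d\times\mathbb R^d : |u|=|v|=|u-v|=1\}.$$ Let $\mu$ be the surface measure on the compact $(2d-3)$-dimensional submanifold $M$ of $\mathbb R^{2d}$, normalized to be a probability measure, and let $$\widehat\mu(\xi,\eta)=\int_M e^{-2\pi i(\xi\cdot u+\eta\cdot v)}\,d\mu(u,v),\qquad \xi,\eta\in\mathbb R^d .$$ Then $\widehat\mu$ is a $C^\infty$ function on $\mathbb R^d\times\mathbb R^d$, and for all multi-indices $\alpha,\beta\in\mathbb Z_{\ge0}^d$ there is a constant $C_{\alpha,\beta}$ (depending only on $\alpha$, $\beta$ and $d$) such that for all $\xi,\eta\in\mathbb R^d$ $$\bigl|\partial_\xi^\alpha\partial_\eta^\beta\widehat\mu(\xi,\eta)\bigr|\le C_{\alpha,\beta}\,\bigl(1+\min\{|\xi|,|\eta|\}\,|\sin\theta|\bigr)^{-\frac{d-2}{2}}\bigl(1+|(\xi,\eta)|\bigr)^{-\frac{d-2}{2}},$$ where $\theta$ is the angle between $\xi$ and $\eta$ (irrelevant if $\xi=0$ or $\eta=0$) and $|(\xi,\eta)|=(|\xi|^2+|\eta|^2)^{1/2}$.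 -/

import Mathlib

open scoped ContDiff

noncomputable section

namespace TriangleAveraging

/-- The Euclidean space `ℝ^d`. -/
abbrev E (d : ℕ) : Type := EuclideanSpace ℝ (Fin d)

/-- `ℝ^d × ℝ^d` with the Euclidean (`ℓ²`) metric, that is, `ℝ^{2d}`. -/
abbrev E₂ (d : ℕ) : Type := WithLp 2 (E d × E d)

/-- The manifold `M` of pairs `(u, v)` such that `{0, u, v}` is the set of vertices of an
equilateral triangle of side length `1`. -/
def M (d : ℕ) : Set (E₂ d) :=
  {p | ‖p.fst‖ = 1 ∧ ‖p.snd‖ = 1 ∧ ‖p.fst - p.snd‖ = 1}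

/-- The normalized surface measure on `M`. The manifold `M` has dimension
`(d - 1) + (d - 2) = 2 d - 3`; its surface measure is the `(2 d - 3)`-dimensional Hausdorff measure
of the ambient Euclidean space `ℝ^{2d}`, restricted to `M`. Conditioning on `M` restricts to `M`
and divides by the total mass of `M`. -/
def surfaceMeasure (d : ℕ) : MeasureTheory.Measure (E₂ d) :=
  ProbabilityTheory.cond (MeasureTheory.Measure.hausdorffMeasure (2 * (d : ℝ) - 3)) (M d)

/-- The Fourier transform
`(ξ, η) ↦ ∫_M exp (-2 π i (ξ · u + η · v)) dμ(u, v)` of the surface measure. -/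
def muHat (d : ℕ) (ζ : E d × E d) : ℂ :=
  ∫ p : E₂ d, Complex.exp
    (-2 * (Real.pi : ℂ) * Complex.I * ((inner ℝ ζ.1 p.fst + inner ℝ ζ.2 p.snd : ℝ) : ℂ))
    ∂(surfaceMeasure d)

/-- The first-order partial derivative `∂ / ∂ξ_i` of a function of `(ξ, η)`. -/
def partialXi {d : ℕ} (i : Fin d) (F : E d × E d → ℂ) : E d × E d → ℂ :=
  fun ζ => lineDeriv ℝ F ζ (EuclideanSpace.single i 1, 0)

/-- The first-order partial derivative `∂ / ∂η_i` of a function of `(ξ, η)`. -/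
def partialEta {d : ℕ} (i : Fin d) (F : E d × E d → ℂ) : E d × E d → ℂ :=
  fun ζ => lineDeriv ℝ F ζ (0, EuclideanSpace.single i 1)

/-- `∂_ξ^α = ∂_{ξ_1}^{α_1} ⋯ ∂_{ξ_d}^{α_d}` for a multi-index `α`. -/
def multiXi {d : ℕ} (α : Fin d → ℕ) (F : E d × E d → ℂ) : E d × E d → ℂ :=
  (List.finRange d).foldr (fun i G => (partialXi i)^[α i] G) F

/-- `∂_η^β = ∂_{η_1}^{β_1} ⋯ ∂_{η_d}^{β_d}` for a multi-index `β`. -/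
def multiEta {d : ℕ} (β : Fin d → ℕ) (F : E d × E d → ℂ) : E d × E d → ℂ :=
  (List.finRange d).foldr (fun i G => (partialEta i)^[β i] G) F

end TriangleAveraging

end

/-!
The derivatives of `μ̂` are the integrals `∫ exp (-2πi (ξ · u + η · v)) a (u, v) dμ` with smooth
amplitudes `a` (`SmoothTransform`), so the theorem is a decay estimate for such integrals
(`exists_muHatWith_bound`). Only two properties of `μ` are used: its mass is at most `1`, and, being
defined by a Hausdorff measure, it is invariant under the isometries of `ℝ^{2d}` that preserve `M`,
namely the diagonal action of the orthogonal group and the exchange of `u` and `v`.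

By the exchange symmetry, let `|η| ≤ |ξ|`. Choose an orthonormal basis `b` with `ξ = σ₁ b₀` and
`η = c ξ + σ₂ b₁`, where `|c| ≤ 1`, `σ₁ = |ξ|` and `σ₂ = |η| |sin θ|` is at most `σ₁`. The phase is
then `s₁ ⟨b₀, u + c v⟩ + s₂ ⟨b₁, v⟩` with `s_j = 2π σ_j` (`PhaseData`, `exists_phaseData`). The
rotation in the plane of `b₀` and `b_k`, `k ≥ 2`, differentiates the phase to
`- s₁ ⟨b_k, u + c v⟩`, and the rotation in the plane of `b₁` and `b_k` to `- s₂ ⟨b_k, v⟩`. Since `μ`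
is rotation invariant, one can integrate by parts along these fields, and each step gains a factor
`W₁ ^ (-1/2)` or `W₂ ^ (-1/2)` with
`W₁ = 1 + s₁ ∑ ⟨b_k, u + c v⟩²`, `W₂ = 1 + s₂ ∑ ⟨b_k, v⟩²` (`RotationData.exists_parts`).
The amplitudes that arise are controlled by a symbol calculus that is uniform in all parameters: a
derivative costs at most `max (1, s_j) ^ (1/2)` (`IsSymbol`). The fields of the second kind have to
be used first, because the weights `W₂` vary more slowly than `W₁` and so remain admissible for the
fields of the first kind, but not conversely. The outcome is a bound by `∫ W₁ ^ (-2d) W₂ ^ (-d) dμ`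
(`PhaseData.exists_norm_integral_le`).

No cancellation is left in this last integral. By averaging over the orthogonal group it is compared
with an integral over pairs of vectors in the unit ball of `ℝ^d` with Lebesgue measure
(`volume_mul_lintegral_le`): every such pair `(a₁, a₂)` is, by Gram–Schmidt, an upper triangular
combination with bounded coefficients of the vectors `u + c v` and `v` of some rotated
configuration (`exists_triangular`). The Lebesgue integral factorizes and is evaluated in
coordinates (`lintegral_cap_le`); each factor is `O (max (1, s_j) ^ (-(d-2)/2))`, which is the
claim.
-/

noncomputable section

namespace TriangleAveraging

/-! ### Families of symbols -/

section Symbols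

variable {ι V F G : Type*} [NormedAddCommGroup V] [NormedSpace ℝ V]
  [NormedAddCommGroup F] [NormedSpace ℝ F] [NormedAddCommGroup G] [NormedSpace ℝ G]

/-- The `n`-th derivatives of the functions `f i` are bounded on `K` by a constant multiple of
`r i ^ n * w i`, uniformly in the parameter `i`. -/
def DerivBound (K : Set V) (r : ι → ℝ) (w : ι → V → ℝ) (n : ℕ) (f : ι → V → F) : Prop :=
  ∃ C, 0 ≤ C ∧ ∀ i, ∀ x ∈ K, ‖iteratedFDeriv ℝ n (f i) x‖ ≤ C * (r i ^ n * w i x)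

/-- A family of smooth functions `f i` is a symbol of weight `w` and frequency scale `r` on `K` if
each derivative costs at most a factor `r i`, uniformly in the parameter `i`. The functions are
defined on the whole space; only the bounds are restricted to `K`. -/
structure IsSymbol (K : Set V) (r : ι → ℝ) (w : ι → V → ℝ) (f : ι → V → F) : Prop where
  contDiff : ∀ i, ContDiff ℝ ∞ (f i)
  bound : ∀ n, DerivBound K r w n f

variable {K : Set V} {r r' : ι → ℝ} {w w' : ι → V → ℝ}

/-- Bounds of Leibniz type turn derivative bounds for two factors into one for their product. -/
lemma DerivBound.of_leibniz {H : Type*} [NormedAddCommGroup H] [NormedSpace ℝ H] {n : ℕ}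
    {f : ι → V → F} {g : ι → V → G} {h : ι → V → H}
    (hf : ∀ m ≤ n, DerivBound K r w m f) (hg : ∀ m ≤ n, DerivBound K r w' m g)
    (hh : ∀ i x, ‖iteratedFDeriv ℝ n (h i) x‖ ≤ ∑ m ∈ Finset.range (n + 1),
      (n.choose m : ℝ) * ‖iteratedFDeriv ℝ m (f i) x‖ * ‖iteratedFDeriv ℝ (n - m) (g i) x‖) :
    DerivBound K r (fun i x => w i x * w' i x) n h := by
  choose! C hC0 hC using hf
  choose! D hD0 hD using hg
  refine ⟨∑ m ∈ Finset.range (n + 1), (n.choose m : ℝ) * (C m * D (n - m)), ?_, ?_⟩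
  · refine Finset.sum_nonneg fun m hm => ?_
    have hm' : m ≤ n := Nat.lt_succ_iff.mp (Finset.mem_range.mp hm)
    exact mul_nonneg (Nat.cast_nonneg _) (mul_nonneg (hC0 m hm') (hD0 _ (Nat.sub_le _ _)))
  · intro i x hx
    refine (hh i x).trans ?_
    rw [Finset.sum_mul]
    refine Finset.sum_le_sum fun m hm => ?_
    have hm' : m ≤ n := Nat.lt_succ_iff.mp (Finset.mem_range.mp hm)
    have h1 := hC m hm' i x hx
    have h2 := hD (n - m) (Nat.sub_le _ _) i x hx
    have h3 : r i ^ m * r i ^ (n - m) = r i ^ n := by rw [← pow_add, Nat.add_sub_cancel' hm']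
    calc (n.choose m : ℝ) * ‖iteratedFDeriv ℝ m (f i) x‖ * ‖iteratedFDeriv ℝ (n - m) (g i) x‖
        ≤ (n.choose m : ℝ) * (C m * (r i ^ m * w i x)) * (D (n - m) * (r i ^ (n - m) * w' i x)) := by
          have h0 : (0 : ℝ) ≤ C m * (r i ^ m * w i x) := (norm_nonneg _).trans h1
          gcongr
      _ = (n.choose m : ℝ) * (C m * D (n - m)) * ((r i ^ m * r i ^ (n - m)) * (w i x * w' i x)) := by
          ring
      _ = _ := by rw [h3]

lemma DerivBound.mono {n : ℕ} {f : ι → V → F} (hf : DerivBound K r w n f) {A : ℝ}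
    (hr : ∀ i, 0 ≤ r i) (hrr : ∀ i, r i ≤ r' i) (hA : 0 ≤ A)
    (h0 : ∀ i, ∀ x ∈ K, 0 ≤ w i x)
    (h : ∀ i, ∀ x ∈ K, w i x ≤ A * w' i x) : DerivBound K r' w' n f := by
  obtain ⟨C, hC0, hC⟩ := hf
  refine ⟨C * A, mul_nonneg hC0 hA, fun i x hx => (hC i x hx).trans ?_⟩
  have h1 := h i x hx
  have h2 := h0 i x hx
  have h3 := hr i
  have h4 := hrr i
  have h5 : 0 ≤ r' i := h3.trans h4
  calc C * (r i ^ n * w i x) ≤ C * (r' i ^ n * (A * w' i x)) := by gcongr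
    _ = _ := by ring

lemma IsSymbol.mono {f : ι → V → F} (hf : IsSymbol K r w f) {A : ℝ}
    (hr : ∀ i, 0 ≤ r i) (hrr : ∀ i, r i ≤ r' i) (hA : 0 ≤ A)
    (h0 : ∀ i, ∀ x ∈ K, 0 ≤ w i x)
    (h : ∀ i, ∀ x ∈ K, w i x ≤ A * w' i x) : IsSymbol K r' w' f :=
  ⟨hf.contDiff, fun n => (hf.bound n).mono hr hrr hA h0 h⟩

/-- A change of weight without change of scale. -/
lemma IsSymbol.of_le {f : ι → V → F} (hf : IsSymbol K r w f) (A : ℝ)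
    (hr : ∀ i, 0 ≤ r i) (hA : 0 ≤ A) (h0 : ∀ i, ∀ x ∈ K, 0 ≤ w i x)
    (h : ∀ i, ∀ x ∈ K, w i x ≤ A * w' i x) : IsSymbol K r w' f :=
  hf.mono hr (fun _ => le_rfl) hA h0 h

lemma IsSymbol.congr_weight {f : ι → V → F} (hf : IsSymbol K r w f)
    (h : ∀ i, ∀ x ∈ K, w i x = w' i x) : IsSymbol K r w' f :=
  ⟨hf.contDiff, fun n => by
    obtain ⟨C, hC0, hC⟩ := hf.bound n
    exact ⟨C, hC0, fun i x hx => by rw [← h i x hx]; exact hC i x hx⟩⟩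

lemma IsSymbol.add {f g : ι → V → F} (hf : IsSymbol K r w f) (hg : IsSymbol K r w g) :
    IsSymbol K r w (fun i x => f i x + g i x) := by
  refine ⟨fun i => (hf.contDiff i).add (hg.contDiff i), fun n => ?_⟩
  obtain ⟨C, hC0, hC⟩ := hf.bound n
  obtain ⟨D, hD0, hD⟩ := hg.bound n
  refine ⟨C + D, add_nonneg hC0 hD0, fun i x hx => ?_⟩
  rw [fun_iteratedFDeriv_add_apply ((hf.contDiff i).of_le (by exact_mod_cast le_top)).contDiffAt
    ((hg.contDiff i).of_le (by exact_mod_cast le_top)).contDiffAt, add_mul]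
  exact (norm_add_le _ _).trans (add_le_add (hC i x hx) (hD i x hx))

lemma IsSymbol.zero :
    IsSymbol K r w (fun _ _ => (0 : F)) :=
  ⟨fun _ => contDiff_const, fun n => ⟨0, le_rfl, fun i x hx => by simp⟩⟩

lemma IsSymbol.sum {κ : Type*} (s : Finset κ) {f : κ → ι → V → F}
    (hf : ∀ k ∈ s, IsSymbol K r w (f k)) :
    IsSymbol K r w (fun i x => ∑ k ∈ s, f k i x) := by
  classical
  induction s using Finset.induction_on with
  | empty => simpa using IsSymbol.zero
  | insert a s ha ih =>
    simp_rw [Finset.sum_insert ha]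
    exact (hf a (Finset.mem_insert_self _ _)).add
      (ih fun k hk => hf k (Finset.mem_insert_of_mem hk))

lemma IsSymbol.mul {f g : ι → V → ℂ} (hf : IsSymbol K r w f) (hg : IsSymbol K r w' g) :
    IsSymbol K r (fun i x => w i x * w' i x) (fun i x => f i x * g i x) :=
  ⟨fun i => (hf.contDiff i).mul (hg.contDiff i), fun n =>
    .of_leibniz (fun m _ => hf.bound m) (fun m _ => hg.bound m) fun i x =>
      norm_iteratedFDeriv_mul_le (hf.contDiff i) (hg.contDiff i) x (by exact_mod_cast le_top)⟩

/-- Continuous linear maps of bounded norm are symbols of weight `w` as soon as `w` bounds their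
values and `1 / r` is controlled by `w`. -/
lemma IsSymbol.of_clm {ℓ : ι → V →L[ℝ] F} {B : ℝ} (hB : ∀ i, ‖ℓ i‖ ≤ B)
    {A : ℝ} (hA : ∀ i, ∀ x ∈ K, ‖ℓ i x‖ ≤ A * w i x) (h1 : ∀ i, ∀ x ∈ K, 1 ≤ r i * w i x)
    (h0 : ∀ i, ∀ x ∈ K, 0 ≤ w i x) :
    IsSymbol K r w (fun i x => ℓ i x) := by
  refine ⟨fun i => (ℓ i).contDiff, fun n => ?_⟩
  match n with
  | 0 =>
    refine ⟨|A|, abs_nonneg A, fun i x hx => ?_⟩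
    rw [norm_iteratedFDeriv_zero, pow_zero, one_mul]
    exact (hA i x hx).trans (mul_le_mul_of_nonneg_right (le_abs_self A) (h0 i x hx))
  | 1 =>
    refine ⟨|B|, abs_nonneg B, fun i x hx => ?_⟩
    rw [← norm_iteratedFDeriv_fderiv, norm_iteratedFDeriv_zero, pow_one,
      ContinuousLinearMap.fderiv]
    calc ‖ℓ i‖ ≤ |B| * 1 := by rw [mul_one]; exact (hB i).trans (le_abs_self B)
      _ ≤ |B| * (r i * w i x) := mul_le_mul_of_nonneg_left (h1 i x hx) (abs_nonneg _)
  | n + 2 =>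
    refine ⟨0, le_rfl, fun i x hx => ?_⟩
    have : fderiv ℝ (fun x => ℓ i x) = fun _ => ℓ i := by
      ext1 y; exact (ℓ i).fderiv
    rw [← norm_iteratedFDeriv_fderiv, this, iteratedFDeriv_succ_const]
    simp

lemma IsSymbol.const {c : F} (h1 : ∀ i, ∀ x ∈ K, 1 ≤ w i x) :
    IsSymbol K r w (fun _ _ => c) := by
  refine ⟨fun i => contDiff_const, fun n => ?_⟩
  match n with
  | 0 =>
    refine ⟨‖c‖, norm_nonneg c, fun i x hx => ?_⟩
    rw [norm_iteratedFDeriv_zero, pow_zero, one_mul]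
    exact le_mul_of_one_le_right (norm_nonneg c) (h1 i x hx)
  | n + 1 =>
    refine ⟨0, le_rfl, fun i x hx => ?_⟩
    rw [iteratedFDeriv_succ_const]
    simp

/-- Multiplication by constants that depend on the parameter. -/
lemma IsSymbol.const_mul {f : ι → V → ℂ} (hf : IsSymbol K r w f) {c : ι → ℂ} :
    IsSymbol K r (fun i x => ‖c i‖ * w i x) (fun i x => c i * f i x) := by
  refine ⟨fun i => contDiff_const.mul (hf.contDiff i), fun n => ?_⟩
  obtain ⟨C, hC0, hC⟩ := hf.bound n
  refine ⟨C, hC0, fun i x hx => ?_⟩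
  show ‖iteratedFDeriv ℝ n (fun x => c i • f i x) x‖ ≤ _
  rw [iteratedFDeriv_const_smul_apply'
    ((hf.contDiff i).of_le (by exact_mod_cast le_top)).contDiffAt, norm_smul]
  calc ‖c i‖ * ‖iteratedFDeriv ℝ n (f i) x‖ ≤ ‖c i‖ * (C * (r i ^ n * w i x)) :=
        mul_le_mul_of_nonneg_left (hC i x hx) (norm_nonneg _)
    _ = _ := by ring

lemma DerivBound.fderiv {n : ℕ} {f : ι → V → F} (hf : DerivBound K r w (n + 1) f) :
    DerivBound K r (fun i x => r i * w i x) n (fun i => fderiv ℝ (f i)) := by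
  obtain ⟨C, hC0, hC⟩ := hf
  refine ⟨C, hC0, fun i x hx => ?_⟩
  rw [norm_iteratedFDeriv_fderiv]
  refine (hC i x hx).trans (le_of_eq ?_)
  ring

/-- Differentiating a symbol along linear vector fields of bounded norm costs a factor `r`. -/
lemma IsSymbol.fderiv_apply {f : ι → V → F} (hf : IsSymbol K r w f) {Z : ι → V →L[ℝ] V}
    {B R : ℝ} (hZ : ∀ i, ‖Z i‖ ≤ B) (hK : ∀ x ∈ K, ‖x‖ ≤ R) (hr : ∀ i, 1 ≤ r i) :
    IsSymbol K r (fun i x => r i * w i x) (fun i x => fderiv ℝ (f i) x (Z i x)) := by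
  have hZs : IsSymbol K r (fun _ _ => 1) (fun i x => Z i x) := by
    refine IsSymbol.of_clm hZ (A := |B| * R) (fun i x hx => ?_) (fun i x _ => by simpa using hr i)
      (fun _ _ _ => zero_le_one)
    rw [mul_one]
    exact ((Z i).le_opNorm x).trans (mul_le_mul ((hZ i).trans (le_abs_self B)) (hK x hx)
      (norm_nonneg _) (abs_nonneg _))
  have hfd : ∀ i, ContDiff ℝ ∞ (_root_.fderiv ℝ (f i)) := fun i =>
    (hf.contDiff i).fderiv_right (by simp)
  have := fun n => DerivBound.of_leibniz (n := n) (K := K) (r := r)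
    (h := fun i x => _root_.fderiv ℝ (f i) x (Z i x))
    (fun m _ => (hf.bound (m + 1)).fderiv) (fun m _ => hZs.bound m) fun i x =>
      norm_iteratedFDeriv_clm_apply (hfd i) (hZs.contDiff i) x (by exact_mod_cast le_top)
  refine IsSymbol.congr_weight (w := fun i x => r i * w i x * 1)
    ⟨fun i => (hfd i).clm_apply (hZs.contDiff i), this⟩ (fun _ _ _ => mul_one _)

/-- The reciprocal of a symbol of weight `w` that is bounded below by its weight is a symbol of
weight `1 / w`. -/
lemma IsSymbol.inv {f : ι → V → ℂ} (hf : IsSymbol K r w f) (hne : ∀ i x, f i x ≠ 0)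
    (hw : ∀ i, ∀ x ∈ K, 0 < w i x) (hfw : ∀ i, ∀ x ∈ K, w i x ≤ ‖f i x‖) :
    IsSymbol K r (fun i x => (w i x)⁻¹) (fun i x => (f i x)⁻¹) := by
  have hcd : ∀ i, ContDiff ℝ ∞ (fun x => (f i x)⁻¹) := fun i => (hf.contDiff i).inv (hne i)
  refine ⟨hcd, fun n => ?_⟩
  induction n using Nat.strong_induction_on with
  | _ n ih =>
    match n with
    | 0 =>
      refine ⟨1, zero_le_one, fun i x hx => ?_⟩
      rw [norm_iteratedFDeriv_zero, pow_zero, one_mul, one_mul, norm_inv]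
      exact inv_anti₀ (hw i x hx) (hfw i x hx)
    | n + 1 =>
      -- `D (1 / f) = - (1 / f) ^ 2 • D f`, where only derivatives of `1 / f` of order at most `n`
      -- enter the `n`-th derivative of the right-hand side.
      have hD : ∀ i, _root_.fderiv ℝ (fun x => (f i x)⁻¹) =
          fun x => (-((f i x)⁻¹ * (f i x)⁻¹)) • _root_.fderiv ℝ (f i) x := by
        intro i
        ext1 x
        have h1 : HasFDerivAt (f i) (_root_.fderiv ℝ (f i) x) x :=
          ((hf.contDiff i).differentiable (by simp)).differentiableAt.hasFDerivAt
        have h2 := ((hasDerivAt_inv (hne i x)).comp_hasFDerivAt x h1).fderiv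
        have h3 : (Inv.inv ∘ f i) = fun x => (f i x)⁻¹ := rfl
        rw [h3] at h2
        rw [h2]
        congr 1
        rw [← mul_inv, sq]
      have hm1 : ∀ m ≤ n, DerivBound K r (fun i x => (w i x)⁻¹ * (w i x)⁻¹) m
          (fun i x => (f i x)⁻¹ * (f i x)⁻¹) := fun m hm =>
        .of_leibniz (fun k hk => ih k (by omega)) (fun k hk => ih k (by omega)) fun i x =>
          norm_iteratedFDeriv_mul_le (hcd i) (hcd i) x (by exact_mod_cast le_top)
      have hm2 : ∀ m ≤ n, DerivBound K r (fun i x => (w i x)⁻¹ * (w i x)⁻¹) m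
          (fun i x => -((f i x)⁻¹ * (f i x)⁻¹)) := by
        intro m hm
        obtain ⟨C, hC0, hC⟩ := hm1 m hm
        refine ⟨C, hC0, fun i x hx => ?_⟩
        show ‖iteratedFDeriv ℝ m (-(fun x => (f i x)⁻¹ * (f i x)⁻¹)) x‖ ≤ _
        rw [iteratedFDeriv_neg_apply, norm_neg]
        exact hC i x hx
      have hfd : ∀ i, ContDiff ℝ ∞ (_root_.fderiv ℝ (f i)) := fun i =>
        (hf.contDiff i).fderiv_right (by simp)
      obtain ⟨C, hC0, hC⟩ := DerivBound.of_leibniz (n := n) hm2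
        (fun m _ => (hf.bound (m + 1)).fderiv)
        (h := fun i x => (-((f i x)⁻¹ * (f i x)⁻¹)) • _root_.fderiv ℝ (f i) x) fun i x =>
          norm_iteratedFDeriv_smul_le ((hcd i).mul (hcd i)).neg (hfd i) x
            (by exact_mod_cast le_top)
      refine ⟨C, hC0, fun i x hx => ?_⟩
      rw [← norm_iteratedFDeriv_fderiv, hD]
      refine (hC i x hx).trans (le_of_eq ?_)
      have := (hw i x hx).ne'
      rw [pow_succ]
      field_simp

/-- A single smooth function is a symbol of weight `1` on every compact set. -/
lemma IsSymbol.of_contDiff {a : V → F} (ha : ContDiff ℝ ∞ a) (hK : IsCompact K)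
    (hr : ∀ i, 1 ≤ r i) : IsSymbol K r (fun _ _ => 1) (fun _ : ι => a) := by
  refine ⟨fun _ => ha, fun n => ?_⟩
  obtain ⟨C, hC⟩ := hK.exists_bound_of_continuousOn
    (f := iteratedFDeriv ℝ n a) (ha.continuous_iteratedFDeriv (by exact_mod_cast le_top)).continuousOn
  refine ⟨|C|, abs_nonneg C, fun i x hx => (hC x hx).trans ((le_abs_self C).trans ?_)⟩
  rw [mul_one]
  exact le_mul_of_one_le_right (abs_nonneg C) (one_le_pow₀ (hr i))

end Symbols

/-! ### The configuration manifold and its symmetries -/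

section Geometry

open MeasureTheory

variable {d : ℕ}

/-- A shortcut: without it, instance search unfolds the nested `ℓ²` structures. -/
instance continuousSMul_E (d : ℕ) : ContinuousSMul ℝ (E d) := IsBoundedSMul.continuousSMul

/-- A shortcut, as for `E d`. -/
instance continuousSMul_E₂ (d : ℕ) : ContinuousSMul ℝ (E₂ d) := IsBoundedSMul.continuousSMul

lemma norm_le_two_of_mem_M {p : E₂ d} (hp : p ∈ M d) : ‖p‖ ≤ 2 := by
  have := WithLp.prod_norm_sq_eq_of_L2 p
  rw [hp.1, hp.2.1] at this
  nlinarith [norm_nonneg p]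

lemma isCompact_M (d : ℕ) : IsCompact (M d) := by
  have hf : Continuous fun p : E₂ d => p.fst := (WithLp.fstL 2 ℝ (E d) (E d)).continuous
  have hs : Continuous fun p : E₂ d => p.snd := (WithLp.sndL 2 ℝ (E d) (E d)).continuous
  refine Metric.isCompact_of_isClosed_isBounded ?_ ?_
  · exact (isClosed_eq hf.norm continuous_const).inter
      ((isClosed_eq hs.norm continuous_const).inter
        (isClosed_eq (hf.sub hs).norm continuous_const))
  · refine isBounded_iff_forall_norm_le.mpr ⟨2, fun p hp => norm_le_two_of_mem_M hp⟩

lemma measurableSet_M (d : ℕ) : MeasurableSet (M d) := (isCompact_M d).isClosed.measurableSet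

lemma mem_M_iff {p : E₂ d} :
    p ∈ M d ↔ ‖p.fst‖ = 1 ∧ ‖p.snd‖ = 1 ∧ inner ℝ p.fst p.snd = (1 / 2 : ℝ) := by
  refine and_congr_right fun h1 => and_congr_right fun h2 => ?_
  have h := norm_sub_sq_real p.fst p.snd
  rw [h1, h2] at h
  constructor
  · intro h3
    rw [h3] at h
    linarith
  · intro h3
    rw [h3] at h
    have : ‖p.fst - p.snd‖ ^ 2 = 1 := by rw [h]; norm_num
    nlinarith [norm_nonneg (p.fst - p.snd)]

lemma ae_mem_M (d : ℕ) : ∀ᵐ p ∂(surfaceMeasure d), p ∈ M d := by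
  have : (surfaceMeasure d) (M d)ᶜ = 0 := by
    rw [surfaceMeasure, ProbabilityTheory.cond_apply (measurableSet_M d)]
    simp
  exact this

instance isZeroOrProbabilityMeasure_surfaceMeasure (d : ℕ) :
    IsZeroOrProbabilityMeasure (surfaceMeasure d) := by
  unfold surfaceMeasure
  infer_instance

/-- The surface measure is invariant under every isometry of the ambient space that preserves
`M`. -/
lemma measurePreserving_surfaceMeasure (e : E₂ d ≃ᵢ E₂ d) (he : ∀ p, e p ∈ M d ↔ p ∈ M d) :
    MeasurePreserving e (surfaceMeasure d) (surfaceMeasure d) := by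
  have h1 := (e.measurePreserving_hausdorffMeasure (2 * (d : ℝ) - 3)).restrict_preimage
    (measurableSet_M d)
  have h2 : e ⁻¹' (M d) = M d := Set.ext he
  rw [h2] at h1
  exact h1.smul_measure _

/-- The diagonal action `(u, v) ↦ (A u, A v)` of a linear map. -/
def diag (A : E d →L[ℝ] E d) : E₂ d →L[ℝ] E₂ d :=
  (WithLp.prodContinuousLinearEquiv 2 ℝ (E d) (E d)).symm.toContinuousLinearMap ∘L
    (A.prodMap A) ∘L (WithLp.prodContinuousLinearEquiv 2 ℝ (E d) (E d)).toContinuousLinearMap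

@[simp] lemma diag_fst (A : E d →L[ℝ] E d) (p : E₂ d) : (diag A p).fst = A p.fst := rfl

@[simp] lemma diag_snd (A : E d →L[ℝ] E d) (p : E₂ d) : (diag A p).snd = A p.snd := rfl

lemma diag_mul (A B : E d →L[ℝ] E d) (p : E₂ d) : diag (A * B) p = diag A (diag B p) := rfl

lemma norm_diag_le (A : E d →L[ℝ] E d) : ‖diag A‖ ≤ ‖A‖ := by
  refine ContinuousLinearMap.opNorm_le_bound _ (norm_nonneg _) fun p => ?_
  have h1 := WithLp.prod_norm_sq_eq_of_L2 p
  have h2 := WithLp.prod_norm_sq_eq_of_L2 (diag A p)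
  rw [diag_fst, diag_snd] at h2
  have h3 := pow_le_pow_left₀ (norm_nonneg _) (A.le_opNorm p.fst) 2
  have h4 := pow_le_pow_left₀ (norm_nonneg _) (A.le_opNorm p.snd) 2
  refine le_of_sq_le_sq ?_ (by positivity)
  rw [h2, mul_pow, h1]
  nlinarith

/-- The group of orthogonal transformations of `ℝ^d`. -/
abbrev O (d : ℕ) : Type := unitary (E d →L[ℝ] E d)

lemma diag_mem_M_iff (g : O d) (p : E₂ d) : diag (g : E d →L[ℝ] E d) p ∈ M d ↔ p ∈ M d := by
  rw [mem_M_iff, mem_M_iff, diag_fst, diag_snd, Unitary.norm_map, Unitary.norm_map,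
    Unitary.inner_map_map]

lemma measurePreserving_diag (g : O d) :
    MeasurePreserving (diag (g : E d →L[ℝ] E d)) (surfaceMeasure d) (surfaceMeasure d) := by
  let e := LinearIsometryEquiv.withLpProdCongr 2 (Unitary.linearIsometryEquiv g)
    (Unitary.linearIsometryEquiv g)
  have he : ∀ p, e.toIsometryEquiv p = diag (g : E d →L[ℝ] E d) p := fun p => rfl
  have := measurePreserving_surfaceMeasure e.toIsometryEquiv
    (fun p => by rw [he]; exact diag_mem_M_iff g p)
  exact this

lemma measurePreserving_swap (d : ℕ) :
    MeasurePreserving (LinearIsometryEquiv.withLpProdComm 2 ℝ (E d) (E d))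
      (surfaceMeasure d) (surfaceMeasure d) := by
  refine measurePreserving_surfaceMeasure
    (LinearIsometryEquiv.withLpProdComm 2 ℝ (E d) (E d)).toIsometryEquiv fun p => ?_
  have : (LinearIsometryEquiv.withLpProdComm 2 ℝ (E d) (E d)).toIsometryEquiv p =
      WithLp.toLp 2 (p.snd, p.fst) := rfl
  rw [this, mem_M_iff, mem_M_iff, WithLp.toLp_fst, WithLp.toLp_snd, real_inner_comm]
  tauto

lemma integrable_of_continuous {F : Type*} [NormedAddCommGroup F] {f : E₂ d → F}
    (hf : Continuous f) : Integrable f (surfaceMeasure d) := by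
  obtain ⟨C, hC⟩ := (isCompact_M d).exists_bound_of_continuousOn hf.continuousOn
  exact Integrable.of_bound hf.aestronglyMeasurable C
    ((ae_mem_M d).mono fun p hp => hC p hp)

/-- The flow `exp (t A)` of a skew-adjoint map `A`. -/
lemma exists_rotation_flow {A : E d →L[ℝ] E d} (hA : A ∈ skewAdjoint (E d →L[ℝ] E d)) :
    ∃ g : ℝ → O d, (g 0 : E d →L[ℝ] E d) = 1 ∧
      ∀ t, HasDerivAt (fun t => (g t : E d →L[ℝ] E d)) (A * (g t : E d →L[ℝ] E d)) t := by
  let : NormedAlgebra ℚ (E d →L[ℝ] E d) := NormedAlgebra.restrictScalars ℚ ℝ _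
  refine ⟨fun t => ⟨NormedSpace.exp (t • A), NormedSpace.exp_mem_unitary_of_mem_skewAdjoint
      (skewAdjoint.smul_mem t hA)⟩, ?_, fun t => hasDerivAt_exp_smul_const' A t⟩
  exact (congrArg NormedSpace.exp (zero_smul ℝ A)).trans NormedSpace.exp_zero

lemma hasDerivAt_diag {g : ℝ → E d →L[ℝ] E d} {B : E d →L[ℝ] E d} {t : ℝ}
    (hg : HasDerivAt g B t) (p : E₂ d) : HasDerivAt (fun t => diag (g t) p) (diag B p) t := by
  have h2 := (ContinuousLinearMap.apply ℝ (E d) p.fst).hasFDerivAt.comp_hasDerivAt t hg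
  have h3 := (ContinuousLinearMap.apply ℝ (E d) p.snd).hasFDerivAt.comp_hasDerivAt t hg
  exact ((WithLp.prodContinuousLinearEquiv 2 ℝ (E d) (E d)).symm.toContinuousLinearMap
    ).hasFDerivAt.comp_hasDerivAt t (h2.prodMk h3)

lemma integral_comp_diag (g : O d) {f : E₂ d → ℂ} (hf : Continuous f) :
    ∫ p, f (diag (g : E d →L[ℝ] E d) p) ∂(surfaceMeasure d) = ∫ p, f p ∂(surfaceMeasure d) := by
  have h := measurePreserving_diag g
  have h2 := integral_map (μ := surfaceMeasure d) h.measurable.aemeasurable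
    (f := f) hf.aestronglyMeasurable
  rw [h.map_eq] at h2
  exact h2.symm

/-- Infinitesimal rotation invariance of the surface measure: the derivative of a function along
the vector field generated by a skew-adjoint map has mean zero. -/
lemma integral_fderiv_diag_eq_zero {A : E d →L[ℝ] E d} (hA : A ∈ skewAdjoint (E d →L[ℝ] E d))
    {f : E₂ d → ℂ} (hf : ContDiff ℝ 1 f) :
    ∫ p, fderiv ℝ f p (diag A p) ∂(surfaceMeasure d) = 0 := by
  obtain ⟨g, hg0, hg⟩ := exists_rotation_flow hA
  have hDf : Continuous fun p => fderiv ℝ f p (diag A p) :=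
    (hf.continuous_fderiv (by simp)).clm_apply (diag A).continuous
  obtain ⟨C, hC⟩ := (isCompact_M d).exists_bound_of_continuousOn hDf.continuousOn
  have hG : ∀ t p, HasDerivAt (fun t => f (diag (g t : E d →L[ℝ] E d) p))
      (fderiv ℝ f (diag (g t : E d →L[ℝ] E d) p) (diag A (diag (g t : E d →L[ℝ] E d) p))) t := by
    intro t p
    exact (hf.differentiable (by simp)).differentiableAt.hasFDerivAt.comp_hasDerivAt t
      (hasDerivAt_diag (hg t) p)
  have h1 := (hasDerivAt_integral_of_dominated_loc_of_deriv_le (μ := surfaceMeasure d)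
    (F := fun t p => f (diag (g t : E d →L[ℝ] E d) p))
    (F' := fun t p =>
      fderiv ℝ f (diag (g t : E d →L[ℝ] E d) p) (diag A (diag (g t : E d →L[ℝ] E d) p)))
    (x₀ := (0 : ℝ)) (s := Set.univ) (bound := fun _ => C) Filter.univ_mem
    (.of_forall fun t => (hf.continuous.comp (diag _).continuous).aestronglyMeasurable)
    (integrable_of_continuous (hf.continuous.comp (diag _).continuous))
    (hDf.comp (diag _).continuous).aestronglyMeasurable
    ((ae_mem_M d).mono fun p hp t _ => hC _ ((diag_mem_M_iff (g t) p).mpr hp))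
    (integrable_const C) (.of_forall fun p t _ => hG t p)).2
  simp_rw [integral_comp_diag _ hf.continuous, hg0] at h1
  exact h1.unique (hasDerivAt_const _ _)

/-- Integration by parts along a rotation field. -/
lemma integral_mul_fderiv_diag {A : E d →L[ℝ] E d} (hA : A ∈ skewAdjoint (E d →L[ℝ] E d))
    {f g : E₂ d → ℂ} (hf : ContDiff ℝ 1 f) (hg : ContDiff ℝ 1 g) :
    ∫ p, fderiv ℝ f p (diag A p) * g p ∂(surfaceMeasure d) =
      -∫ p, f p * fderiv ℝ g p (diag A p) ∂(surfaceMeasure d) := by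
  have h : ∫ p, fderiv ℝ (fun p => f p * g p) p (diag A p) ∂(surfaceMeasure d) = 0 :=
    integral_fderiv_diag_eq_zero hA (hf.mul hg)
  have hD : ∀ p, fderiv ℝ (fun p => f p * g p) p (diag A p) =
      fderiv ℝ f p (diag A p) * g p + f p * fderiv ℝ g p (diag A p) := by
    intro p
    rw [fderiv_fun_mul (hf.differentiable (by simp)).differentiableAt
      (hg.differentiable (by simp)).differentiableAt]
    simp only [add_apply, smul_apply, smul_eq_mul]
    ring
  have hcont : ∀ {h : E₂ d → ℂ}, ContDiff ℝ 1 h →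
      Continuous fun p => fderiv ℝ h p (diag A p) := fun hh =>
    (hh.continuous_fderiv (by simp)).clm_apply (diag A).continuous
  simp_rw [hD] at h
  refine eq_neg_of_add_eq_zero_left (Eq.trans (integral_add
    (integrable_of_continuous ((hcont hf).mul hg.continuous))
    (integrable_of_continuous (hf.continuous.mul (hcont hg)))).symm h)

/-- The generator `e ⊗ e' - e' ⊗ e` of the rotations in the plane spanned by `e` and `e'`. -/
def rotField (e e' : E d) : E d →L[ℝ] E d :=
  (innerSL ℝ e).smulRight e' - (innerSL ℝ e').smulRight e

lemma rotField_apply (e e' x : E d) :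
    rotField e e' x = (inner ℝ e x : ℝ) • e' - (inner ℝ e' x : ℝ) • e := rfl

lemma rotField_mem_skewAdjoint (e e' : E d) :
    rotField e e' ∈ skewAdjoint (E d →L[ℝ] E d) := by
  rw [skewAdjoint.mem_iff, ContinuousLinearMap.star_eq_adjoint]
  symm
  rw [ContinuousLinearMap.eq_adjoint_iff]
  intro x y
  simp only [neg_apply, rotField_apply, inner_neg_left, inner_sub_left,
    inner_sub_right, real_inner_smul_left, real_inner_smul_right]
  rw [real_inner_comm x e, real_inner_comm x e']
  ring

lemma norm_rotField_le {e e' : E d} (he : ‖e‖ = 1) (he' : ‖e'‖ = 1) : ‖rotField e e'‖ ≤ 2 := by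
  refine (norm_sub_le _ _).trans ?_
  rw [ContinuousLinearMap.norm_smulRight_apply, ContinuousLinearMap.norm_smulRight_apply,
    innerSL_apply_norm, innerSL_apply_norm, he, he']
  norm_num

end Geometry

/-! ### Integration by parts with rotation fields -/

section Parts

open MeasureTheory Complex

variable {d : ℕ} {ι : Type*}

/-- A family of linear phases `Φ i` on the space of pairs, together with the rotations in the
planes spanned by `b j` and `b k`, for `k` in a set `J` of indices. The derivative of `Φ i` along
such a rotation is `- s i` times the `k`-th coordinate of the vector `L i p`. -/
structure RotationData (ι : Type*) (d : ℕ) where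
  /-- the orthonormal frames in which the rotations are taken -/
  b : ι → OrthonormalBasis (Fin d) ℝ (E d)
  /-- the index of the common direction of the planes of rotation -/
  j : Fin d
  /-- the indices of the second directions of the planes of rotation -/
  J : Finset (Fin d)
  /-- the vector whose coordinates are the derivatives of the phase -/
  L : ι → E₂ d →L[ℝ] E d
  /-- the frequency -/
  s : ι → ℝ
  /-- the phase -/
  Φ : ι → E₂ d →L[ℝ] ℝ
  norm_L_le : ∀ i, ‖L i‖ ≤ 2
  s_nonneg : ∀ i, 0 ≤ s i
  phase_rot : ∀ i, ∀ k ∈ J, ∀ p,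
    Φ i (diag (rotField (b i j) (b i k)) p) = -(s i * inner ℝ (b i k) (L i p))

namespace RotationData

variable (D : RotationData ι d)

/-- The coordinate `⟨b k, L p⟩`, as a complex-valued linear function of `p`. -/
def coord (i : ι) (k : Fin d) : E₂ d →L[ℝ] ℂ :=
  ofRealCLM ∘L (innerSL ℝ (D.b i k)) ∘L (D.L i)

/-- The weight `1 + s ∑ ⟨b k, L p⟩ ^ 2`. The sum measures how far the phase is from being stationary
at `p` under the rotations; the weight is large once the sum exceeds `1 / s`. -/
def W (i : ι) (p : E₂ d) : ℝ := 1 + D.s i * ∑ k ∈ D.J, (inner ℝ (D.b i k) (D.L i p)) ^ 2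

/-- The cost of one derivative of a function of `W`, namely `max (1, s) ^ (1 / 2)`. -/
def scale (i : ι) : ℝ := √(max 1 (D.s i))

lemma coord_apply (i : ι) (k : Fin d) (p : E₂ d) :
    D.coord i k p = ((inner ℝ (D.b i k) (D.L i p) : ℝ) : ℂ) := rfl

lemma one_le_W (i : ι) (p : E₂ d) : 1 ≤ D.W i p := by
  have := mul_nonneg (D.s_nonneg i)
    (Finset.sum_nonneg fun k (_ : k ∈ D.J) => sq_nonneg (inner ℝ (D.b i k) (D.L i p)))
  unfold W
  linarith

lemma continuous_inv_W_pow (i : ι) (n : ℕ) : Continuous fun p => (D.W i p ^ n)⁻¹ := by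
  have : Continuous (D.W i) := by
    unfold W
    exact continuous_const.add (continuous_const.mul (continuous_finsetSum _ fun k _ =>
      ((innerSL ℝ (D.b i k)).continuous.comp (D.L i).continuous).pow 2))
  exact (this.pow n).inv₀ fun p => (pow_pos (zero_lt_one.trans_le (D.one_le_W i p)) n).ne'

lemma one_le_sqrt_W (i : ι) (p : E₂ d) : 1 ≤ √(D.W i p) := Real.one_le_sqrt.mpr (D.one_le_W i p)

lemma one_le_scale (i : ι) : 1 ≤ D.scale i := Real.one_le_sqrt.mpr (le_max_left _ _)

lemma scale_nonneg (i : ι) : 0 ≤ D.scale i := Real.sqrt_nonneg _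

lemma scale_sq (i : ι) : D.scale i ^ 2 = max 1 (D.s i) :=
  Real.sq_sqrt (zero_le_one.trans (le_max_left _ _))

lemma norm_coord_le (i : ι) (k : Fin d) : ‖D.coord i k‖ ≤ 2 := by
  refine ContinuousLinearMap.opNorm_le_bound _ zero_le_two fun p => ?_
  rw [coord_apply, norm_real]
  calc ‖(inner ℝ (D.b i k) (D.L i p) : ℝ)‖ ≤ ‖D.b i k‖ * ‖D.L i p‖ := norm_inner_le_norm _ _
    _ = ‖D.L i p‖ := by rw [(D.b i).orthonormal.1 k, one_mul]
    _ ≤ 2 * ‖p‖ := ((D.L i).le_opNorm p).trans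
      (mul_le_mul_of_nonneg_right (D.norm_L_le i) (norm_nonneg p))

lemma scale_mul_coord_le (i : ι) {k : Fin d} (hk : k ∈ D.J) {p : E₂ d} (hp : p ∈ M d) :
    D.scale i * ‖D.coord i k p‖ ≤ 4 * √(D.W i p) := by
  have h1 : ‖D.coord i k p‖ ≤ 4 := by
    refine ((D.coord i k).le_opNorm p).trans ?_
    have := norm_le_two_of_mem_M hp
    have := D.norm_coord_le i k
    nlinarith [norm_nonneg p, norm_nonneg (D.coord i k)]
  have h2 : D.s i * ‖D.coord i k p‖ ^ 2 ≤ D.W i p := by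
    have h3 : ‖D.coord i k p‖ ^ 2 ≤ ∑ k ∈ D.J, (inner ℝ (D.b i k) (D.L i p)) ^ 2 := by
      rw [coord_apply, norm_real, Real.norm_eq_abs, sq_abs]
      exact Finset.single_le_sum (f := fun k => (inner ℝ (D.b i k) (D.L i p) : ℝ) ^ 2)
        (fun k _ => sq_nonneg _) hk
    have := mul_le_mul_of_nonneg_left h3 (D.s_nonneg i)
    unfold W
    linarith
  refine le_of_sq_le_sq ?_ (by positivity)
  rw [mul_pow, mul_pow, D.scale_sq, Real.sq_sqrt (zero_le_one.trans (D.one_le_W i p))]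
  have h4 := D.one_le_W i p
  rcases max_cases 1 (D.s i) with ⟨h, _⟩ | ⟨h, _⟩ <;> rw [h]
  · nlinarith [norm_nonneg (D.coord i k p)]
  · linarith

/-- `W` as a complex-valued function. -/
lemma ofReal_W (i : ι) (p : E₂ d) :
    ((D.W i p : ℝ) : ℂ) = 1 + (D.s i : ℂ) * ∑ k ∈ D.J, D.coord i k p * D.coord i k p := by
  simp only [W, coord_apply]
  push_cast
  simp only [sq]

lemma isSymbol_coord {k : Fin d} (hk : k ∈ D.J) :
    IsSymbol (M d) D.scale (fun i p => (D.scale i)⁻¹ * √(D.W i p))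
      (fun i p => D.coord i k p) := by
  have hs : ∀ i, 0 < D.scale i := fun i => zero_lt_one.trans_le (D.one_le_scale i)
  refine IsSymbol.of_clm (fun i => D.norm_coord_le i k) (A := 4) (fun i p hp => ?_)
    (fun i p _ => ?_) (fun i p _ => mul_nonneg (inv_nonneg.mpr (hs i).le) (Real.sqrt_nonneg _))
  · have := D.scale_mul_coord_le i hk hp
    rw [← mul_assoc, mul_comm 4, mul_assoc, le_inv_mul_iff₀ (hs i)]
    exact this
  · rw [mul_inv_cancel_left₀ (hs i).ne']
    exact D.one_le_sqrt_W i p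

lemma isSymbol_W : IsSymbol (M d) D.scale D.W (fun i p => ((D.W i p : ℝ) : ℂ)) := by
  simp_rw [ofReal_W]
  refine (IsSymbol.const fun i p _ => D.one_le_W i p).add ?_
  refine (IsSymbol.sum D.J fun k hk => (D.isSymbol_coord hk).mul (D.isSymbol_coord hk)).const_mul.of_le
    1 D.scale_nonneg zero_le_one (fun i p _ => ?_) (fun i p _ => ?_)
  · exact mul_nonneg (norm_nonneg _) (mul_self_nonneg _)
  · have h1 : D.s i ≤ D.scale i ^ 2 := by rw [D.scale_sq]; exact le_max_right _ _
    have h2 := Real.sq_sqrt (zero_le_one.trans (D.one_le_W i p))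
    have h3 := zero_lt_one.trans_le (D.one_le_scale i)
    rw [norm_real, Real.norm_of_nonneg (D.s_nonneg i), one_mul]
    calc D.s i * ((D.scale i)⁻¹ * √(D.W i p) * ((D.scale i)⁻¹ * √(D.W i p)))
        = (D.s i / D.scale i ^ 2) * (√(D.W i p)) ^ 2 := by field_simp
      _ ≤ 1 * D.W i p := by
        rw [h2]
        refine mul_le_mul_of_nonneg_right ?_ (zero_le_one.trans (D.one_le_W i p))
        exact div_le_one_of_le₀ h1 (sq_nonneg _)
      _ = D.W i p := one_mul _

lemma W_ne_zero (i : ι) (p : E₂ d) : ((D.W i p : ℝ) : ℂ) ≠ 0 :=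
  ofReal_ne_zero.mpr (zero_lt_one.trans_le (D.one_le_W i p)).ne'

lemma isSymbol_inv_W :
    IsSymbol (M d) D.scale (fun i p => (D.W i p)⁻¹) (fun i p => ((D.W i p : ℝ) : ℂ)⁻¹) := by
  refine D.isSymbol_W.inv D.W_ne_zero (fun i p _ => zero_lt_one.trans_le (D.one_le_W i p))
    fun i p _ => ?_
  rw [norm_real]
  exact le_abs_self _

/-- The oscillating factor `exp (- i Φ)`. -/
def osc (i : ι) (p : E₂ d) : ℂ := cexp (-I * ((D.Φ i p : ℝ) : ℂ))

lemma contDiff_osc (i : ι) : ContDiff ℝ ∞ (D.osc i) :=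
  (contDiff_const.mul (ofRealCLM.contDiff.comp (D.Φ i).contDiff)).cexp

lemma norm_osc (i : ι) (p : E₂ d) : ‖D.osc i p‖ = 1 := by
  unfold osc
  rw [show -I * ((D.Φ i p : ℝ) : ℂ) = ((-(D.Φ i p) : ℝ) : ℂ) * I by push_cast; ring]
  exact norm_exp_ofReal_mul_I _

/-- The field of rotations in the plane of `b j` and `b k`. -/
def field (i : ι) (k : Fin d) : E₂ d →L[ℝ] E₂ d := diag (rotField (D.b i D.j) (D.b i k))

lemma norm_field_le (i : ι) (k : Fin d) : ‖D.field i k‖ ≤ 2 :=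
  (norm_diag_le _).trans (norm_rotField_le ((D.b i).orthonormal.1 _) ((D.b i).orthonormal.1 _))

lemma fderiv_osc (i : ι) {k : Fin d} (hk : k ∈ D.J) (p : E₂ d) :
    fderiv ℝ (D.osc i) p (D.field i k p) = I * D.s i * D.coord i k p * D.osc i p := by
  have h1 : HasFDerivAt (fun p => -I * ((D.Φ i p : ℝ) : ℂ)) (-I • (ofRealCLM ∘L D.Φ i)) p :=
    (ofRealCLM ∘L D.Φ i).hasFDerivAt.const_mul (-I)
  have h2 : HasFDerivAt (D.osc i) _ p := h1.cexp
  rw [h2.fderiv]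
  have h3 := D.phase_rot i k hk p
  simp only [smul_apply, ContinuousLinearMap.comp_apply, ofRealCLM_apply, field, h3, smul_eq_mul,
    coord_apply]
  unfold osc
  push_cast
  ring

/-- One integration by parts against the oscillating factor gains the factor `W ^ (- 1 / 2)`. -/
lemma exists_parts {w : ι → E₂ d → ℝ} {f : ι → E₂ d → ℂ} (hf : IsSymbol (M d) D.scale w f)
    (hw : ∀ i, ∀ p ∈ M d, 0 ≤ w i p) :
    ∃ f' : ι → E₂ d → ℂ, IsSymbol (M d) D.scale (fun i p => w i p * (√(D.W i p))⁻¹) f' ∧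
      ∀ i, ∫ p, D.osc i p * f i p ∂(surfaceMeasure d) =
        ∫ p, D.osc i p * f' i p ∂(surfaceMeasure d) := by
  -- From `W e = e - i ∑ x_k D_k e`, where `e` is the oscillating factor and `D_k` the rotation
  -- fields, the transposed operator is `f ↦ f / W + i ∑ D_k (x_k f / W)`.
  let h : ι → E₂ d → ℂ := fun i p => f i p * ((D.W i p : ℝ) : ℂ)⁻¹
  let g : Fin d → ι → E₂ d → ℂ := fun k i p => D.coord i k p * h i p
  let Dg : Fin d → ι → E₂ d → ℂ := fun k i p => fderiv ℝ (g k i) p (D.field i k p)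
  have hh : IsSymbol (M d) D.scale (fun i p => w i p * (D.W i p)⁻¹) h := hf.mul D.isSymbol_inv_W
  have hg : ∀ k ∈ D.J, IsSymbol (M d) D.scale
      (fun i p => (D.scale i)⁻¹ * √(D.W i p) * (w i p * (D.W i p)⁻¹)) (g k) :=
    fun k hk => (D.isSymbol_coord hk).mul hh
  have hpos : ∀ i p, 0 < √(D.W i p) := fun i p => zero_lt_one.trans_le (D.one_le_sqrt_W i p)
  have hsq : ∀ i p, √(D.W i p) * √(D.W i p) = D.W i p := fun i p =>
    Real.mul_self_sqrt (zero_le_one.trans (D.one_le_W i p))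
  refine ⟨fun i p => h i p + ∑ k ∈ D.J, I * Dg k i p, ?_, fun i => ?_⟩
  · refine (hh.of_le 1 D.scale_nonneg zero_le_one (fun i p hp => mul_nonneg (hw i p hp)
      (inv_nonneg.mpr (zero_le_one.trans (D.one_le_W i p)))) fun i p hp => ?_).add
      (IsSymbol.sum _ fun k hk => ?_)
    · rw [one_mul]
      refine mul_le_mul_of_nonneg_left (inv_anti₀ (hpos i p) ?_) (hw i p hp)
      have := D.one_le_sqrt_W i p
      nlinarith [hsq i p]
    · refine (IsSymbol.const_mul (c := fun _ => I) ((hg k hk).fderiv_apply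
        (fun i => D.norm_field_le i k) (fun p hp => norm_le_two_of_mem_M hp)
        D.one_le_scale)).congr_weight fun i p _ => ?_
      have h1 := (hpos i p).ne'
      have h2 := (zero_lt_one.trans_le (D.one_le_scale i)).ne'
      have h3 : (D.W i p)⁻¹ = (√(D.W i p))⁻¹ * (√(D.W i p))⁻¹ := by rw [← mul_inv, hsq]
      rw [norm_I, h3]
      field_simp
  · have hcE := (D.contDiff_osc i).continuous
    have hch := (hh.contDiff i).continuous
    have hcDg : ∀ k ∈ D.J, Continuous (Dg k i) := fun k hk =>
      (((hg k hk).contDiff i).continuous_fderiv (by simp)).clm_apply (D.field i k).continuous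
    have hcDE : ∀ k, Continuous fun p => fderiv ℝ (D.osc i) p (D.field i k p) := fun k =>
      ((D.contDiff_osc i).continuous_fderiv (by simp)).clm_apply (D.field i k).continuous
    have h1 : ∀ p, D.osc i p * f i p = D.osc i p * h i p +
        ∑ k ∈ D.J, -I * (fderiv ℝ (D.osc i) p (D.field i k p) * g k i p) := by
      intro p
      have e1 : ∀ k ∈ D.J, -I * (fderiv ℝ (D.osc i) p (D.field i k p) * g k i p) =
          (D.osc i p * h i p) * ((D.s i : ℂ) * (D.coord i k p * D.coord i k p)) := by
        intro k hk
        rw [D.fderiv_osc i hk]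
        simp only [g]
        linear_combination
          (-(D.s i : ℂ) * D.coord i k p * D.osc i p * (D.coord i k p * h i p)) * I_mul_I
      rw [Finset.sum_congr rfl e1, ← Finset.mul_sum, ← Finset.mul_sum]
      have e2 := D.ofReal_W i p
      have e3 : f i p = h i p * ((D.W i p : ℝ) : ℂ) := by
        simp only [h]
        rw [inv_mul_cancel_right₀ (D.W_ne_zero i p)]
      rw [e3, e2]
      ring
    have h2 : ∀ k ∈ D.J, ∫ p, -I * (fderiv ℝ (D.osc i) p (D.field i k p) * g k i p)
        ∂(surfaceMeasure d) = ∫ p, I * (D.osc i p * Dg k i p) ∂(surfaceMeasure d) := by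
      intro k hk
      rw [integral_const_mul, integral_const_mul]
      have := integral_mul_fderiv_diag (rotField_mem_skewAdjoint (D.b i D.j) (D.b i k))
        ((D.contDiff_osc i).of_le (by simp)) (((hg k hk).contDiff i).of_le (by simp))
      simp only [Dg, field]
      rw [this]
      ring
    have hi1 : Integrable (fun p => D.osc i p * h i p) (surfaceMeasure d) :=
      integrable_of_continuous (hcE.mul hch)
    have hi2 : ∀ k ∈ D.J, Integrable (fun p =>
        -I * (fderiv ℝ (D.osc i) p (D.field i k p) * g k i p)) (surfaceMeasure d) := fun k hk =>
      integrable_of_continuous (continuous_const.mul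
        ((hcDE k).mul ((hg k hk).contDiff i).continuous))
    have hi3 : ∀ k ∈ D.J, Integrable (fun p => I * (D.osc i p * Dg k i p)) (surfaceMeasure d) :=
      fun k hk => integrable_of_continuous (continuous_const.mul (hcE.mul (hcDg k hk)))
    simp_rw [h1]
    rw [integral_add hi1 (integrable_finsetSum _ hi2), integral_finsetSum _ hi2,
      Finset.sum_congr rfl h2, ← integral_finsetSum _ hi3,
      ← integral_add hi1 (integrable_finsetSum _ hi3)]
    congr 1
    ext1 p
    rw [mul_add, Finset.mul_sum]
    congr 1
    refine Finset.sum_congr rfl fun k _ => ?_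
    ring

/-- Repeated integration by parts gains an arbitrary power of `W`. -/
lemma exists_parts_iterate (N : ℕ) {w : ι → E₂ d → ℝ} {f : ι → E₂ d → ℂ}
    (hf : IsSymbol (M d) D.scale w f) (hw : ∀ i, ∀ p ∈ M d, 0 ≤ w i p) :
    ∃ f' : ι → E₂ d → ℂ, IsSymbol (M d) D.scale (fun i p => w i p * (D.W i p ^ N)⁻¹) f' ∧
      ∀ i, ∫ p, D.osc i p * f i p ∂(surfaceMeasure d) =
        ∫ p, D.osc i p * f' i p ∂(surfaceMeasure d) := by
  induction N with
  | zero => exact ⟨f, by simpa using hf, fun _ => rfl⟩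
  | succ N ih =>
    obtain ⟨f₁, hf₁, h₁⟩ := ih
    have hn : ∀ i p, 0 ≤ (D.W i p ^ N)⁻¹ := fun i p =>
      inv_nonneg.mpr (pow_nonneg (zero_le_one.trans (D.one_le_W i p)) _)
    obtain ⟨f₂, hf₂, h₂⟩ := D.exists_parts hf₁ fun i p hp => mul_nonneg (hw i p hp) (hn i p)
    obtain ⟨f₃, hf₃, h₃⟩ := D.exists_parts hf₂ fun i p hp =>
      mul_nonneg (mul_nonneg (hw i p hp) (hn i p)) (inv_nonneg.mpr (Real.sqrt_nonneg _))
    refine ⟨f₃, hf₃.congr_weight fun i p _ => ?_, fun i => by rw [h₁, h₂, h₃]⟩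
    rw [mul_assoc, mul_assoc, ← mul_inv, ← mul_inv,
      Real.mul_self_sqrt (zero_le_one.trans (D.one_le_W i p)), pow_succ]

end RotationData

end Parts

/-! ### Reduction of the oscillatory integral to a weight integral -/

section Weights

open MeasureTheory Complex

variable {d : ℕ}

/-- The parameters of the phases `s₁ ⟨b i₀, u + c v⟩ + s₂ ⟨b i₁, v⟩`, where `b` is an orthonormal
basis. Up to exchanging `u` and `v`, every phase `ξ · u + η · v` is of this form. -/
structure PhaseData (d : ℕ) where
  /-- the orthonormal frame adapted to the two frequencies -/
  b : OrthonormalBasis (Fin d) ℝ (E d)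
  /-- the component of the smaller frequency along the larger one -/
  c : ℝ
  /-- the length of the larger frequency -/
  s₁ : ℝ
  /-- the length of the part of the smaller frequency orthogonal to the larger one -/
  s₂ : ℝ
  abs_c_le : |c| ≤ 1
  s₂_nonneg : 0 ≤ s₂
  s₂_le : s₂ ≤ s₁

/-- The linear map `(u, v) ↦ u + c v`. -/
def shear (c : ℝ) : E₂ d →L[ℝ] E d :=
  WithLp.fstL 2 ℝ (E d) (E d) + c • WithLp.sndL 2 ℝ (E d) (E d)

/-- The linear map `(u, v) ↦ v`. -/
def second (d : ℕ) : E₂ d →L[ℝ] E d := WithLp.sndL 2 ℝ (E d) (E d)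

lemma shear_apply (c : ℝ) (p : E₂ d) : shear c p = p.fst + c • p.snd := rfl

lemma second_apply (p : E₂ d) : second d p = p.snd := rfl

lemma norm_fst_le (p : E₂ d) : ‖p.fst‖ ≤ ‖p‖ := by
  have := WithLp.prod_norm_sq_eq_of_L2 p
  refine le_of_sq_le_sq ?_ (norm_nonneg _)
  nlinarith [sq_nonneg ‖p.snd‖]

lemma norm_snd_le (p : E₂ d) : ‖p.snd‖ ≤ ‖p‖ := by
  have := WithLp.prod_norm_sq_eq_of_L2 p
  refine le_of_sq_le_sq ?_ (norm_nonneg _)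
  nlinarith [sq_nonneg ‖p.fst‖]

lemma norm_shear_le {c : ℝ} (hc : |c| ≤ 1) : ‖shear (d := d) c‖ ≤ 2 := by
  refine ContinuousLinearMap.opNorm_le_bound _ zero_le_two fun p => ?_
  rw [shear_apply]
  refine (norm_add_le _ _).trans ?_
  rw [norm_smul, Real.norm_eq_abs]
  have h1 := norm_fst_le p
  have h2 := norm_snd_le p
  nlinarith [norm_nonneg p.snd, abs_nonneg c]

lemma norm_second_le : ‖second d‖ ≤ 2 := by
  refine ContinuousLinearMap.opNorm_le_bound _ zero_le_two fun p => ?_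
  rw [second_apply]
  have h2 := norm_snd_le p
  linarith [norm_nonneg p]

namespace PhaseData

/-- The phase `s₁ ⟨b i₀, u + c v⟩ + s₂ ⟨b i₁, v⟩`. -/
def phase (i₀ i₁ : Fin d) (P : PhaseData d) : E₂ d →L[ℝ] ℝ :=
  P.s₁ • (innerSL ℝ (P.b i₀) ∘L shear P.c) + P.s₂ • (innerSL ℝ (P.b i₁) ∘L second d)

lemma phase_apply (i₀ i₁ : Fin d) (P : PhaseData d) (p : E₂ d) :
    phase i₀ i₁ P p = P.s₁ * inner ℝ (P.b i₀) (p.fst + P.c • p.snd) +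
      P.s₂ * inner ℝ (P.b i₁) p.snd := rfl

lemma s₁_nonneg (P : PhaseData d) : 0 ≤ P.s₁ := P.s₂_nonneg.trans P.s₂_le

lemma phase_rotField (i₀ i₁ : Fin d) (P : PhaseData d) (e e' : E d) (p : E₂ d) :
    phase i₀ i₁ P (diag (rotField e e') p) =
      P.s₁ * (inner ℝ e (shear P.c p) * inner ℝ (P.b i₀) e' -
        inner ℝ e' (shear P.c p) * inner ℝ (P.b i₀) e) +
      P.s₂ * (inner ℝ e p.snd * inner ℝ (P.b i₁) e' - inner ℝ e' p.snd * inner ℝ (P.b i₁) e) := by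
  rw [phase_apply, diag_fst, diag_snd, ← map_smul, ← map_add, rotField_apply, rotField_apply,
    shear_apply]
  simp only [inner_sub_right, real_inner_smul_right]

variable {i₀ i₁ : Fin d} (h : i₀ ≠ i₁)

/-- The rotations in the planes containing `b i₀`, which exploit the larger frequency. -/
def large (h : i₀ ≠ i₁) : RotationData (PhaseData d) d where
  b := PhaseData.b
  j := i₀
  J := {i₀, i₁}ᶜ
  L := fun P => shear P.c
  s := PhaseData.s₁
  Φ := phase i₀ i₁
  norm_L_le := fun P => norm_shear_le P.abs_c_le
  s_nonneg := s₁_nonneg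
  phase_rot := by
    intro P k hk p
    rw [Finset.mem_compl, Finset.mem_insert, Finset.mem_singleton, not_or] at hk
    have hP := orthonormal_iff_ite.mp P.b.orthonormal
    rw [phase_rotField]
    simp only [hP, if_neg (Ne.symm hk.1), if_neg (Ne.symm hk.2), if_neg h.symm, if_true]
    ring

/-- The rotations in the planes containing `b i₁`, which exploit the smaller frequency. -/
def small (h : i₀ ≠ i₁) : RotationData (PhaseData d) d where
  b := PhaseData.b
  j := i₁
  J := {i₀, i₁}ᶜ
  L := fun _ => second d
  s := PhaseData.s₂
  Φ := phase i₀ i₁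
  norm_L_le := fun _ => norm_second_le
  s_nonneg := s₂_nonneg
  phase_rot := by
    intro P k hk p
    rw [Finset.mem_compl, Finset.mem_insert, Finset.mem_singleton, not_or] at hk
    have hP := orthonormal_iff_ite.mp P.b.orthonormal
    rw [phase_rotField, second_apply]
    simp only [hP, if_neg (Ne.symm hk.1), if_neg (Ne.symm hk.2), if_neg h, if_true]
    ring

/-- The oscillatory integral is bounded by the integral of weights that are concentrated near the
critical set of the phase. The integrations by parts that use the smaller frequency come first:
the weights they produce vary on the scale `s₂ ^ (- 1 / 2)`, which is coarser than the scale
`s₁ ^ (- 1 / 2)` of the later ones. -/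
lemma exists_norm_integral_le (m n : ℕ) {a : E₂ d → ℂ} (ha : ContDiff ℝ ∞ a) :
    ∃ C, 0 ≤ C ∧ ∀ P : PhaseData d,
      ‖∫ p, cexp (-I * ((phase i₀ i₁ P p : ℝ) : ℂ)) * a p ∂(surfaceMeasure d)‖ ≤
        C * ∫ p, ((large h).W P p ^ m)⁻¹ * ((small h).W P p ^ n)⁻¹ ∂(surfaceMeasure d) := by
  obtain ⟨f, hf, hfa⟩ := (small h).exists_parts_iterate n
    (IsSymbol.of_contDiff ha (isCompact_M d) (small h).one_le_scale)
    (fun _ _ _ => zero_le_one)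
  have hn : ∀ P p, 0 ≤ 1 * ((small h).W P p ^ n)⁻¹ := fun P p =>
    mul_nonneg zero_le_one (inv_nonneg.mpr (pow_nonneg (zero_le_one.trans ((small h).one_le_W P p)) _))
  have hf' : IsSymbol (M d) (large h).scale (fun P p => 1 * ((small h).W P p ^ n)⁻¹) f := by
    refine hf.mono (A := 1) (small h).scale_nonneg (fun P => ?_) zero_le_one
      (fun P p _ => hn P p) (fun P p _ => (one_mul _).ge)
    exact Real.sqrt_le_sqrt (max_le_max le_rfl P.s₂_le)
  obtain ⟨g, hg, hga⟩ := (large h).exists_parts_iterate m hf' (fun P p _ => hn P p)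
  obtain ⟨C, hC0, hC⟩ := hg.bound 0
  refine ⟨C, hC0, fun P => ?_⟩
  have e1 : ∫ p, cexp (-I * ((phase i₀ i₁ P p : ℝ) : ℂ)) * a p ∂(surfaceMeasure d) =
      ∫ p, (large h).osc P p * g P p ∂(surfaceMeasure d) := (hfa P).trans (hga P)
  rw [e1, ← integral_const_mul]
  refine norm_integral_le_of_norm_le (integrable_of_continuous ?_) ((ae_mem_M d).mono fun p hp => ?_)
  · exact continuous_const.mul (((large h).continuous_inv_W_pow P m).mul
      ((small h).continuous_inv_W_pow P n))
  · have := hC P p hp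
    simp only [norm_iteratedFDeriv_zero, pow_zero, one_mul] at this
    rw [norm_mul, RotationData.norm_osc, one_mul, mul_comm ((large h).W P p ^ m)⁻¹]
    exact this

end PhaseData

end Weights

/-! ### Integrals of the weights over balls -/

section Balls

open MeasureTheory

variable {d : ℕ}

/-- The function `1 / (1 + s x ^ 2)` cut off to `[-1, 1]`. -/
def bump (s : ℝ) : ℝ → ℝ := (Set.Icc (-1) 1).indicator fun x => (1 + s * x ^ 2)⁻¹

lemma bump_nonneg {s : ℝ} (hs : 0 ≤ s) (x : ℝ) : 0 ≤ bump s x :=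
  Set.indicator_nonneg (fun x _ => inv_nonneg.mpr (by positivity)) x

lemma continuous_inv_one_add_mul_sq {s : ℝ} (hs : 0 ≤ s) :
    Continuous fun x : ℝ => (1 + s * x ^ 2)⁻¹ :=
  (continuous_const.add (continuous_const.mul (continuous_id.pow 2))).inv₀ fun x =>
    (by positivity : 0 < 1 + s * x ^ 2).ne'

lemma integrable_bump {s : ℝ} (hs : 0 ≤ s) : Integrable (bump s) :=
  (integrable_indicator_iff measurableSet_Icc).mpr
    (continuous_inv_one_add_mul_sq hs).continuousOn.integrableOn_Icc

lemma integral_bump_le {s : ℝ} (hs : 0 ≤ s) : ∫ x, bump s x ≤ 4 / √(max 1 s) := by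
  rcases le_total s 1 with h | h
  · rw [max_eq_left h, Real.sqrt_one, div_one]
    have h1 : ∫ x, bump s x ≤ ∫ x, (Set.Icc (-1 : ℝ) 1).indicator (fun _ => (1 : ℝ)) x := by
      refine integral_mono (integrable_bump hs)
        ((integrable_indicator_iff measurableSet_Icc).mpr (by simp)) fun x => ?_
      refine Set.indicator_le_indicator ?_
      exact inv_le_one_of_one_le₀ (by nlinarith [mul_nonneg hs (sq_nonneg x)])
    refine h1.trans ?_
    rw [integral_indicator measurableSet_Icc]
    simp
    norm_num
  · rw [max_eq_right h]
    have hs0 : 0 < s := zero_lt_one.trans_le h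
    have hr : 0 < √s := Real.sqrt_pos.mpr hs0
    have h2 : (fun x : ℝ => (1 + s * x ^ 2)⁻¹) = fun x => (1 + (√s * x) ^ 2)⁻¹ := by
      ext x
      rw [mul_pow, Real.sq_sqrt hs]
    have h3 : Integrable fun x : ℝ => (1 + s * x ^ 2)⁻¹ := by
      rw [h2]
      exact integrable_inv_one_add_sq.comp_mul_left' hr.ne'
    have h1 : ∫ x, bump s x ≤ ∫ x, (1 + s * x ^ 2)⁻¹ := by
      refine integral_mono (integrable_bump hs) h3 fun x => ?_
      exact Set.indicator_le_self' (fun x _ => inv_nonneg.mpr (by positivity)) x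
    refine h1.trans ?_
    rw [h2, Measure.integral_comp_mul_left (fun x : ℝ => (1 + x ^ 2)⁻¹),
      integral_univ_inv_one_add_sq, smul_eq_mul, abs_of_pos (inv_pos.mpr hr), inv_mul_eq_div]
    exact div_le_div_of_nonneg_right Real.pi_le_four hr.le

/-- Tonelli's theorem in the coordinates of an orthonormal basis. -/
lemma lintegral_prod_inner (b : OrthonormalBasis (Fin d) ℝ (E d)) {f : Fin d → ℝ → ℝ}
    (hf : ∀ k, Integrable (f k)) (h0 : ∀ k x, 0 ≤ f k x) (hm : ∀ k, Measurable (f k)) :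
    ∫⁻ a : E d, ENNReal.ofReal (∏ k, f k (inner ℝ (b k) a)) =
      ENNReal.ofReal (∏ k, ∫ x, f k x) := by
  have hmeas : Measurable fun x : Fin d → ℝ => ENNReal.ofReal (∏ k, f k (x k)) :=
    (Finset.measurable_prod _ fun k _ => (hm k).comp (measurable_pi_apply k)).ennreal_ofReal
  have h1 := (PiLp.volume_preserving_ofLp (Fin d)).comp b.measurePreserving_repr
  have h2 := h1.lintegral_comp hmeas
  have h3 : ∀ a : E d, ((WithLp.ofLp ∘ b.repr) a : Fin d → ℝ) = fun k => inner ℝ (b k) a := by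
    intro a
    ext k
    exact b.repr_apply_apply a k
  simp only [h3] at h2
  rw [h2, ← integral_fintype_prod_volume_eq_prod, ofReal_integral_eq_lintegral_ofReal]
  · exact Integrable.fintype_prod hf
  · exact .of_forall fun x => Finset.prod_nonneg fun k _ => h0 k _

/-- The weight `(1 + s ∑ ⟨b k, a⟩ ^ 2) ^ (- d)`, the sum being over `k ∈ J`, cut off to the unit
ball. -/
def cap (b : OrthonormalBasis (Fin d) ℝ (E d)) (J : Finset (Fin d)) (s : ℝ) : E d → ℝ :=
  (Metric.closedBall 0 1).indicator fun a => ((1 + s * ∑ k ∈ J, (inner ℝ (b k) a) ^ 2) ^ d)⁻¹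

lemma one_le_one_add {b : OrthonormalBasis (Fin d) ℝ (E d)} {J : Finset (Fin d)} {s : ℝ}
    (hs : 0 ≤ s) (a : E d) : 1 ≤ 1 + s * ∑ k ∈ J, (inner ℝ (b k) a) ^ 2 := by
  have := mul_nonneg hs (Finset.sum_nonneg fun k (_ : k ∈ J) => sq_nonneg (inner ℝ (b k) a))
  linarith

lemma measurable_cap (b : OrthonormalBasis (Fin d) ℝ (E d)) (J : Finset (Fin d)) (s : ℝ) :
    Measurable (cap b J s) := by
  refine Measurable.indicator (Measurable.inv ?_) Metric.isClosed_closedBall.measurableSet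
  have : Continuous fun a : E d => (1 + s * ∑ k ∈ J, (inner ℝ (b k) a) ^ 2) ^ d :=
    (continuous_const.add (continuous_const.mul (continuous_finsetSum _ fun k _ =>
      (innerSL ℝ (b k)).continuous.pow 2))).pow d
  exact this.measurable

lemma cap_nonneg {b : OrthonormalBasis (Fin d) ℝ (E d)} {J : Finset (Fin d)} {s : ℝ}
    (hs : 0 ≤ s) (a : E d) : 0 ≤ cap b J s a :=
  Set.indicator_nonneg (fun a _ => inv_nonneg.mpr (pow_nonneg
    (zero_le_one.trans (one_le_one_add hs a)) _)) a

lemma lintegral_cap_le (b : OrthonormalBasis (Fin d) ℝ (E d)) (J : Finset (Fin d)) {s : ℝ}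
    (hs : 0 ≤ s) :
    ∫⁻ a, ENNReal.ofReal (cap b J s a) ≤
      ENNReal.ofReal (4 ^ d * ((√(max 1 s)) ^ J.card)⁻¹) := by
  classical
  let t : Fin d → ℝ := fun k => if k ∈ J then s else 0
  have ht : ∀ k, 0 ≤ t k := fun k => by
    simp only [t]
    split_ifs
    exacts [hs, le_rfl]
  have hle : ∀ a, cap b J s a ≤ ∏ k, bump (t k) (inner ℝ (b k) a) := by
    intro a
    by_cases ha : a ∈ Metric.closedBall (0 : E d) 1
    · have hin : ∀ k, inner ℝ (b k) a ∈ Set.Icc (-1 : ℝ) 1 := fun k => by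
        rw [Set.mem_Icc, ← abs_le]
        refine (abs_real_inner_le_norm _ _).trans ?_
        rw [b.orthonormal.1 k, one_mul]
        simpa using ha
      rw [cap, Set.indicator_of_mem ha]
      simp only [bump, Set.indicator_of_mem (hin _)]
      rw [Finset.prod_inv_distrib]
      refine inv_anti₀ (Finset.prod_pos fun k _ => ?_) ?_
      · have := mul_nonneg (ht k) (sq_nonneg (inner ℝ (b k) a))
        linarith
      · calc ∏ k, (1 + t k * (inner ℝ (b k) a) ^ 2)
            ≤ ∏ _k : Fin d, (1 + s * ∑ k ∈ J, (inner ℝ (b k) a) ^ 2) := by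
              refine Finset.prod_le_prod (fun k _ => ?_) fun k _ => ?_
              · have := mul_nonneg (ht k) (sq_nonneg (inner ℝ (b k) a))
                linarith
              · by_cases hk : k ∈ J
                · simp only [t, if_pos hk]
                  have := mul_le_mul_of_nonneg_left (Finset.single_le_sum
                    (f := fun k => (inner ℝ (b k) a : ℝ) ^ 2) (fun k _ => sq_nonneg _) hk) hs
                  linarith
                · simp only [t, if_neg hk, zero_mul, add_zero]
                  exact one_le_one_add hs a
          _ = _ := by simp
    · rw [cap, Set.indicator_of_notMem ha]
      exact Finset.prod_nonneg fun k _ => bump_nonneg (ht k) _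
  calc ∫⁻ a, ENNReal.ofReal (cap b J s a)
      ≤ ∫⁻ a : E d, ENNReal.ofReal (∏ k, bump (t k) (inner ℝ (b k) a)) :=
        lintegral_mono fun a => ENNReal.ofReal_le_ofReal (hle a)
    _ = ENNReal.ofReal (∏ k, ∫ x, bump (t k) x) :=
        lintegral_prod_inner b (fun k => integrable_bump (ht k)) (fun k => bump_nonneg (ht k))
          fun k => (continuous_inv_one_add_mul_sq (ht k)).measurable.indicator measurableSet_Icc
    _ ≤ ENNReal.ofReal (∏ k, 4 / √(max 1 (t k))) :=
        ENNReal.ofReal_le_ofReal (Finset.prod_le_prod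
          (fun k _ => integral_nonneg (bump_nonneg (ht k))) fun k _ => integral_bump_le (ht k))
    _ = _ := by
        congr 1
        rw [Finset.prod_div_distrib, Finset.prod_const, Finset.card_univ, Fintype.card_fin,
          div_eq_mul_inv]
        congr 2
        have : ∀ k, √(max 1 (t k)) = if k ∈ J then √(max 1 s) else 1 := fun k => by
          simp only [t]
          split_ifs <;> simp
        simp only [this]
        rw [Finset.prod_ite_mem, Finset.univ_inter, Finset.prod_const]

end Balls

/-! ### Averaging over the orthogonal group -/

section Averaging

open MeasureTheory

variable {d : ℕ}

lemma continuousStar_clm {H : Type*} [NormedAddCommGroup H] [InnerProductSpace ℝ H]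
    [CompleteSpace H] : ContinuousStar (H →L[ℝ] H) := inferInstance

/-- Instance search does not identify the topology of the coordinates of `E d` with that of its
norm; the general statement applies by definitional unfolding. -/
instance continuousStar_E (d : ℕ) : ContinuousStar (E d →L[ℝ] E d) := continuousStar_clm

instance compactSpace_O (d : ℕ) : CompactSpace (O d) := by
  have : ProperSpace (E d →L[ℝ] E d) := FiniteDimensional.proper ℝ _
  refine isCompact_iff_compactSpace.mp (Metric.isCompact_of_isClosed_isBounded ?_ ?_)
  · exact isClosed_unitary
  · refine isBounded_iff_forall_norm_le.mpr ⟨1, fun g hg => ?_⟩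
    refine ContinuousLinearMap.opNorm_le_bound _ zero_le_one fun x => ?_
    rw [one_mul]
    exact (Unitary.norm_map ⟨g, hg⟩ x).le

instance secondCountableTopology_O (d : ℕ) : SecondCountableTopology (O d) := by
  have : ProperSpace (E d →L[ℝ] E d) := FiniteDimensional.proper ℝ _
  have : SecondCountableTopology (E d →L[ℝ] E d) := inferInstance
  exact TopologicalSpace.Subtype.secondCountableTopology _

instance measurableSpace_O (d : ℕ) : MeasurableSpace (O d) := borel _

instance borelSpace_O (d : ℕ) : BorelSpace (O d) := ⟨rfl⟩

/-- The Haar probability measure of the orthogonal group. -/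
def haarO (d : ℕ) : Measure (O d) := Measure.haarMeasure ⊤

instance isProbabilityMeasure_haarO (d : ℕ) : IsProbabilityMeasure (haarO d) :=
  ⟨Measure.haarMeasure_self (K₀ := ⊤)⟩

instance isMulLeftInvariant_haarO (d : ℕ) : (haarO d).IsMulLeftInvariant := by
  unfold haarO; infer_instance

instance : OpensMeasurableSpace (O d × (E d × E d)) := inferInstance
instance : OpensMeasurableSpace (O d × (E₂ d)) := inferInstance


lemma continuous_apply_O : Continuous fun z : O d × E d => (z.1 : E d →L[ℝ] E d) z.2 :=
  (continuous_subtype_val.comp continuous_fst).clm_apply continuous_snd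

lemma continuous_diag_O :
    Continuous fun z : O d × E₂ d => diag (z.1 : E d →L[ℝ] E d) z.2 := by
  have h1 : Continuous fun z : O d × E₂ d => z.2.fst :=
    (WithLp.fstL 2 ℝ (E d) (E d)).continuous.comp continuous_snd
  have h2 : Continuous fun z : O d × E₂ d => z.2.snd :=
    (WithLp.sndL 2 ℝ (E d) (E d)).continuous.comp continuous_snd
  exact (WithLp.prodContinuousLinearEquiv 2 ℝ (E d) (E d)).symm.continuous.comp
    ((continuous_apply_O.comp (continuous_fst.prodMk h1)).prodMk
      (continuous_apply_O.comp (continuous_fst.prodMk h2)))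

lemma measurePreserving_O (g : O d) :
    MeasurePreserving (fun A : E d × E d => ((g : E d →L[ℝ] E d) A.1, (g : E d →L[ℝ] E d) A.2)) := by
  have h : MeasurePreserving (fun x : E d => (g : E d →L[ℝ] E d) x) :=
    (Unitary.linearIsometryEquiv g).measurePreserving
  exact h.prod h

/-- The average of a function over an orbit of the orthogonal group does not depend on the base
point of the orbit. -/
lemma lintegral_diag_inv (φ : E₂ d → ENNReal) (g : O d) (p : E₂ d) :
    ∫⁻ k : O d, φ (diag ((k⁻¹ : O d) : E d →L[ℝ] E d) (diag (g : E d →L[ℝ] E d) p)) ∂(haarO d) =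
      ∫⁻ k : O d, φ (diag ((k⁻¹ : O d) : E d →L[ℝ] E d) p) ∂(haarO d) := by
  rw [← lintegral_mul_left_eq_self _ g]
  refine lintegral_congr fun k => ?_
  rw [← diag_mul, ← Submonoid.coe_mul, mul_inv_rev, inv_mul_cancel_right]

/-- Comparison of the surface measure with Lebesgue measure: both are invariant under rotations,
so it suffices to compare `φ` and `H` along the orbits of the orthogonal group. -/
lemma volume_mul_lintegral_le {φ : E₂ d → ENNReal} (hφ : Measurable φ)
    {H : E d × E d → ENNReal} (hH : Measurable H) {S : Set (E d × E d)} (hS : MeasurableSet S)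
    (h : ∀ p ∈ M d, ∀ A ∈ S, ∃ g : O d, ∀ k : O d,
      φ (diag (k : E d →L[ℝ] E d) (diag (g : E d →L[ℝ] E d) p)) ≤
        H ((k : E d →L[ℝ] E d) A.1, (k : E d →L[ℝ] E d) A.2)) :
    volume S * ∫⁻ p, φ p ∂(surfaceMeasure d) ≤ ∫⁻ A, H A := by
  have hΦ : Measurable fun z : O d × E₂ d => φ (diag ((z.1⁻¹ : O d) : E d →L[ℝ] E d) z.2) :=
    hφ.comp (continuous_diag_O.comp (continuous_fst.inv.prodMk continuous_snd)).measurable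
  have hHm : Measurable fun z : O d × (E d × E d) =>
      H (((z.1⁻¹ : O d) : E d →L[ℝ] E d) z.2.1, ((z.1⁻¹ : O d) : E d →L[ℝ] E d) z.2.2) := by
    refine hH.comp (Continuous.measurable ?_)
    exact (continuous_apply_O.comp
        (continuous_fst.inv.prodMk (continuous_fst.comp continuous_snd))).prodMk
      (continuous_apply_O.comp
        (continuous_fst.inv.prodMk (continuous_snd.comp continuous_snd)))
  let Ψ : E₂ d → ENNReal := fun p =>
    ∫⁻ k : O d, φ (diag ((k⁻¹ : O d) : E d →L[ℝ] E d) p) ∂(haarO d)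
  have h1 : ∫⁻ p, φ p ∂(surfaceMeasure d) = ∫⁻ p, Ψ p ∂(surfaceMeasure d) := by
    simp only [Ψ]
    rw [← lintegral_lintegral_swap hΦ.aemeasurable]
    have : ∀ k : O d, ∫⁻ p, φ (diag ((k⁻¹ : O d) : E d →L[ℝ] E d) p) ∂(surfaceMeasure d) =
        ∫⁻ p, φ p ∂(surfaceMeasure d) := fun k =>
      (measurePreserving_diag k⁻¹).lintegral_comp hφ
    simp only [this, lintegral_const, measure_univ, mul_one]
  have h2 : ∫⁻ A, H A = ∫⁻ A : E d × E d, ∫⁻ k : O d, H (((k⁻¹ : O d) : E d →L[ℝ] E d) A.1,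
      ((k⁻¹ : O d) : E d →L[ℝ] E d) A.2) ∂(haarO d) := by
    rw [← lintegral_lintegral_swap hHm.aemeasurable]
    have : ∀ k : O d, ∫⁻ A : E d × E d, H (((k⁻¹ : O d) : E d →L[ℝ] E d) A.1,
        ((k⁻¹ : O d) : E d →L[ℝ] E d) A.2) = ∫⁻ A, H A := fun k =>
      (measurePreserving_O k⁻¹).lintegral_comp hH
    simp only [this, lintegral_const, measure_univ, mul_one]
  have h3 : ∀ p ∈ M d, volume S * Ψ p ≤ ∫⁻ A, H A := by
    intro p hp
    rw [h2]
    calc volume S * Ψ p = ∫⁻ _ in S, Ψ p := by rw [setLIntegral_const, mul_comm]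
      _ ≤ ∫⁻ A in S, ∫⁻ k : O d, H (((k⁻¹ : O d) : E d →L[ℝ] E d) A.1,
            ((k⁻¹ : O d) : E d →L[ℝ] E d) A.2) ∂(haarO d) := by
          refine setLIntegral_mono' hS fun A hA => ?_
          obtain ⟨g, hg⟩ := h p hp A hA
          simp only [Ψ]
          rw [← lintegral_diag_inv φ g p]
          exact lintegral_mono fun k => hg k⁻¹
      _ ≤ _ := setLIntegral_le_lintegral _ _
  rw [h1, ← lintegral_const_mul _ hΦ.lintegral_prod_left]
  calc ∫⁻ p, volume S * Ψ p ∂(surfaceMeasure d)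
      ≤ ∫⁻ _, (∫⁻ A, H A) ∂(surfaceMeasure d) :=
        lintegral_mono_ae ((ae_mem_M d).mono fun p hp => h3 p hp)
    _ = (∫⁻ A, H A) * surfaceMeasure d Set.univ := lintegral_const _
    _ ≤ (∫⁻ A, H A) * 1 := by gcongr; exact prob_le_one
    _ = _ := mul_one _

/-- Every pair of vectors is upper triangular in some orthonormal basis. -/
lemma exists_frame {i₀ i₁ : Fin d} (h : i₀ ≠ i₁) (x y : E d) :
    ∃ (b : OrthonormalBasis (Fin d) ℝ (E d)) (β γ : ℝ), 0 ≤ γ ∧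
      x = ‖x‖ • b i₀ ∧ y = β • b i₀ + γ • b i₁ := by
  classical
  set e : E d := ‖x‖⁻¹ • x with he
  set w : E d := y - (inner ℝ e y : ℝ) • e with hw
  set f : E d := ‖w‖⁻¹ • w with hf
  have hn : ∀ z : E d, ‖z‖⁻¹ • z ≠ 0 → ‖‖z‖⁻¹ • z‖ = 1 := fun z hz => by
    have : z ≠ 0 := fun h0 => hz (by rw [h0, smul_zero])
    rw [norm_smul, norm_inv, norm_norm, inv_mul_cancel₀ (norm_ne_zero_iff.mpr this)]
  have hz : ∀ z : E d, ‖z‖ • (‖z‖⁻¹ • z) = z := fun z => by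
    by_cases h0 : z = 0
    · simp [h0]
    · rw [smul_smul, mul_inv_cancel₀ (norm_ne_zero_iff.mpr h0), one_smul]
  have hew : inner ℝ e w = (0 : ℝ) := by
    by_cases h0 : e = 0
    · rw [h0, inner_zero_left]
    · rw [hw, inner_sub_right, real_inner_smul_right, real_inner_self_eq_norm_sq, hn x h0]
      ring
  have hef : inner ℝ e f = (0 : ℝ) := by rw [hf, real_inner_smul_right, hew, mul_zero]
  -- The normalized vectors may vanish; only the nonzero ones are prescribed.
  let v : Fin d → E d := fun k => if k = i₀ then e else if k = i₁ then f else 0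
  have hv0 : v i₀ = e := if_pos rfl
  have hv1 : v i₁ = f := by simp only [v, if_neg h.symm, if_true]
  have hvn : ∀ k, v k ≠ 0 → k = i₀ ∨ k = i₁ := fun k hk => by
    by_contra hcon
    rw [not_or] at hcon
    exact hk (by simp only [v, if_neg hcon.1, if_neg hcon.2])
  have hon : Orthonormal ℝ (({k | v k ≠ 0} : Set (Fin d)).domRestrict v) := by
    constructor
    · rintro ⟨k, hk⟩
      show ‖v k‖ = 1
      rcases hvn k hk with rfl | rfl
      · rw [hv0]; exact hn x fun h0 => hk (hv0.trans h0)
      · rw [hv1]; exact hn w fun h0 => hk (hv1.trans h0)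
    · rintro ⟨k, hk⟩ ⟨l, hl⟩ hkl
      have hkl' : k ≠ l := fun hh => hkl (Subtype.ext hh)
      show inner ℝ (v k) (v l) = (0 : ℝ)
      rcases hvn k hk with rfl | rfl <;> rcases hvn l hl with rfl | rfl
      · exact absurd rfl hkl'
      · rw [hv0, hv1, hef]
      · rw [hv0, hv1, real_inner_comm, hef]
      · exact absurd rfl hkl'
  obtain ⟨b, hb⟩ := hon.exists_orthonormalBasis_extension_of_card_eq (by simp)
  refine ⟨b, inner ℝ e y, ‖w‖, norm_nonneg _, ?_, ?_⟩
  · by_cases h0 : e = 0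
    · have : x = 0 := by rw [← hz x, ← he, h0, smul_zero]
      simp [this]
    · rw [hb i₀ (by rw [Set.mem_ofPred_eq, hv0]; exact h0), hv0, he, hz]
  · have h1 : (inner ℝ e y : ℝ) • b i₀ = (inner ℝ e y : ℝ) • e := by
      by_cases h0 : e = 0
      · simp [h0]
      · rw [hb i₀ (by rw [Set.mem_ofPred_eq, hv0]; exact h0), hv0]
    have h2 : ‖w‖ • b i₁ = w := by
      by_cases h0 : f = 0
      · have : w = 0 := by rw [← hz w, ← hf, h0, smul_zero]
        simp [this]
      · rw [hb i₁ (by rw [Set.mem_ofPred_eq, hv1]; exact h0), hv1, hf, hz]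
    rw [h1, h2, hw]
    abel

/-- An orthogonal map that takes one orthonormal basis to another. -/
lemma exists_O_apply_basis (b b' : OrthonormalBasis (Fin d) ℝ (E d)) :
    ∃ g : O d, ∀ k, (g : E d →L[ℝ] E d) (b k) = b' k := by
  refine ⟨Unitary.linearIsometryEquiv.symm (b.equiv b' (Equiv.refl _)), fun k => ?_⟩
  rw [Unitary.coe_symm_linearIsometryEquiv_apply]
  exact b.equiv_apply_basis b' (Equiv.refl _) k

lemma norm_shear_sq {p : E₂ d} (hp : p ∈ M d) (c : ℝ) : ‖shear c p‖ ^ 2 = 1 + c + c ^ 2 := by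
  obtain ⟨hu, hv, huv⟩ := mem_M_iff.mp hp
  rw [shear_apply, norm_add_sq_real, real_inner_smul_right, norm_smul, mul_pow, hu, hv, huv,
    Real.norm_eq_abs, sq_abs]
  ring

lemma inner_shear_snd {p : E₂ d} (hp : p ∈ M d) (c : ℝ) :
    inner ℝ (shear c p) p.snd = (1 / 2 + c : ℝ) := by
  obtain ⟨hu, hv, huv⟩ := mem_M_iff.mp hp
  rw [shear_apply, inner_add_left, real_inner_smul_left, real_inner_self_eq_norm_sq, hv, huv]
  ring

lemma triangular_combination {V : Type*} [AddCommGroup V] [Module ℝ V] {e f : V}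
    {X Y Z y z : ℝ} (hX : X ≠ 0) (hZ : Z ≠ 0) :
    y • e + z • f =
      ((y - z * Z⁻¹ * Y) * X⁻¹) • (X • e) + (z * Z⁻¹) • (Y • e + Z • f) := by
  match_scalars
  · field_simp
    ring
  · field_simp

/-- Every pair of vectors in the unit ball is an upper triangular combination, with bounded
coefficients, of the vectors `u + c v` and `v` of some configuration in the orbit of `p`. -/
lemma exists_triangular {i₀ i₁ : Fin d} (h : i₀ ≠ i₁) {c : ℝ} (hc : |c| ≤ 1) {p : E₂ d}
    (hp : p ∈ M d) {a₁ a₂ : E d} (h₁ : ‖a₁‖ ≤ 1) (h₂ : ‖a₂‖ ≤ 1) :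
    ∃ (g : O d) (t₁ t₂ t₃ : ℝ), |t₁| ≤ 6 ∧ |t₂| ≤ 6 ∧ |t₃| ≤ 6 ∧
      a₁ = t₁ • shear c (diag (g : E d →L[ℝ] E d) p) ∧
      a₂ = t₂ • shear c (diag (g : E d →L[ℝ] E d) p) +
        t₃ • (diag (g : E d →L[ℝ] E d) p).snd := by
  obtain ⟨hu, hv, huv⟩ := mem_M_iff.mp hp
  obtain ⟨b, Y, Z, hZ0, hb1, hb2⟩ := exists_frame h (shear c p) p.snd
  obtain ⟨b', y, z, hz0, hb1', hb2'⟩ := exists_frame h a₁ a₂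
  obtain ⟨g, hg⟩ := exists_O_apply_basis b b'
  set X := ‖shear c p‖ with hX
  set x := ‖a₁‖ with hx
  have hon : ∀ (b : OrthonormalBasis (Fin d) ℝ (E d)) (r s : ℝ),
      ‖r • b i₀ + s • b i₁‖ ^ 2 = r ^ 2 + s ^ 2 := fun b r s => by
    have hP := orthonormal_iff_ite.mp b.orthonormal
    rw [← real_inner_self_eq_norm_sq]
    simp only [inner_add_left, inner_add_right, real_inner_smul_left, real_inner_smul_right, hP,
      if_neg h, if_neg h.symm, if_true]
    ring
  have hc' := abs_le.mp hc
  have eX : X ^ 2 = 1 + c + c ^ 2 := norm_shear_sq hp c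
  have eYZ : Y ^ 2 + Z ^ 2 = 1 := by rw [← hon b, ← hb2, hv, one_pow]
  have eXY : X * Y = 1 / 2 + c := by
    have e1 := inner_shear_snd hp c
    have hP := orthonormal_iff_ite.mp b.orthonormal
    rw [hb1, hb2] at e1
    simp only [inner_add_right, real_inner_smul_left, real_inner_smul_right, hP,
      if_neg h, if_true] at e1
    linarith
  have eXZ : X ^ 2 * Z ^ 2 = 3 / 4 := by
    have : X ^ 2 * Z ^ 2 = X ^ 2 - (X * Y) ^ 2 := by
      rw [show Z ^ 2 = 1 - Y ^ 2 by linarith]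
      ring
    rw [this, eX, eXY]
    ring
  have hX0 : 0 ≤ X := norm_nonneg _
  have hXl : 1 / 2 ≤ X := by nlinarith [sq_nonneg (c + 1 / 2)]
  have hXu : X ^ 2 ≤ 3 := by nlinarith
  have hZl : 1 / 2 ≤ Z := by nlinarith [sq_nonneg Z]
  have hYu : |Y| ≤ 1 := abs_le_one_iff_mul_self_le_one.mpr (by nlinarith [sq_nonneg Z])
  have hx0 : 0 ≤ x := norm_nonneg _
  have eyz : y ^ 2 + z ^ 2 ≤ 1 := by
    rw [← hon b', ← hb2']
    exact pow_le_one₀ (norm_nonneg _) h₂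
  have hyu : |y| ≤ 1 := abs_le_one_iff_mul_self_le_one.mpr (by nlinarith [sq_nonneg z])
  have hzu : |z| ≤ 1 := abs_le_one_iff_mul_self_le_one.mpr (by nlinarith [sq_nonneg y])
  have hXi : |X⁻¹| ≤ 2 := by
    rw [abs_inv, abs_of_nonneg hX0]
    exact inv_le_of_inv_le₀ (by norm_num) (by linarith)
  have hZi : |Z⁻¹| ≤ 2 := by
    rw [abs_inv, abs_of_nonneg hZ0]
    exact inv_le_of_inv_le₀ (by norm_num) (by linarith)
  have hXne : X ≠ 0 := by linarith
  have hZne : Z ≠ 0 := by linarith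
  have hg1 : shear c (diag (g : E d →L[ℝ] E d) p) = X • b' i₀ := by
    rw [shear_apply, diag_fst, diag_snd, ← map_smul, ← map_add, ← shear_apply, hb1, map_smul, hg]
  have hg2 : (diag (g : E d →L[ℝ] E d) p).snd = Y • b' i₀ + Z • b' i₁ := by
    rw [diag_snd, hb2, map_add, map_smul, map_smul, hg, hg]
  have hzZ : |z * Z⁻¹| ≤ 2 := by
    rw [abs_mul]
    calc |z| * |Z⁻¹| ≤ 1 * 2 := by gcongr
      _ = 2 := one_mul _
  refine ⟨g, x * X⁻¹, (y - z * Z⁻¹ * Y) * X⁻¹, z * Z⁻¹, ?_, ?_, by linarith, ?_, ?_⟩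
  · rw [abs_mul, abs_of_nonneg hx0]
    calc x * |X⁻¹| ≤ 1 * 2 := by gcongr
      _ ≤ 6 := by norm_num
  · rw [abs_mul]
    have : |y - z * Z⁻¹ * Y| ≤ 3 := by
      have h3 : |y - z * Z⁻¹ * Y| ≤ |y| + |z * Z⁻¹ * Y| := norm_sub_le y (z * Z⁻¹ * Y)
      have h4 : |z * Z⁻¹ * Y| ≤ 2 * 1 := by
        rw [abs_mul (z * Z⁻¹)]
        gcongr
      linarith
    calc |y - z * Z⁻¹ * Y| * |X⁻¹| ≤ 3 * 2 := by gcongr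
      _ = 6 := by norm_num
  · rw [hg1, smul_smul, mul_assoc, inv_mul_cancel₀ hXne, mul_one]
    exact hb1'
  · rw [hg1, hg2]
    exact hb2'.trans (triangular_combination hXne hZne)

end Averaging

/-! ### The decay of the oscillatory integrals -/

section Decay

open MeasureTheory Complex

variable {d : ℕ}

lemma shear_diag (c : ℝ) (A : E d →L[ℝ] E d) (p : E₂ d) :
    shear c (diag A p) = A (shear c p) := by
  rw [shear_apply, shear_apply, diag_fst, diag_snd, map_add, map_smul]

lemma sum_inner_sq_add_le (b : OrthonormalBasis (Fin d) ℝ (E d)) (J : Finset (Fin d))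
    {t₂ t₃ : ℝ} (h₂ : |t₂| ≤ 6) (h₃ : |t₃| ≤ 6) (x y : E d) :
    ∑ k ∈ J, (inner ℝ (b k) (t₂ • x + t₃ • y)) ^ 2 ≤
      72 * (∑ k ∈ J, (inner ℝ (b k) x) ^ 2 + ∑ k ∈ J, (inner ℝ (b k) y) ^ 2) := by
  have h2 : t₂ ^ 2 ≤ 36 := by nlinarith [abs_le.mp h₂]
  have h3 : t₃ ^ 2 ≤ 36 := by nlinarith [abs_le.mp h₃]
  rw [← Finset.sum_add_distrib, Finset.mul_sum]
  refine Finset.sum_le_sum fun k _ => ?_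
  rw [inner_add_right, real_inner_smul_right, real_inner_smul_right]
  set α : ℝ := inner ℝ (b k) x
  set β : ℝ := inner ℝ (b k) y
  nlinarith [sq_nonneg (t₂ * α - t₃ * β), mul_le_mul_of_nonneg_right h2 (sq_nonneg α),
    mul_le_mul_of_nonneg_right h3 (sq_nonneg β)]

namespace PhaseData

variable {i₀ i₁ : Fin d}

/-- Triangularity matters here: `a₁` involves only the vector `u + c v`, which the weights localize
on the finer scale. -/
lemma inv_W_le_cap (h : i₀ ≠ i₁) (P : PhaseData d) {a₁ a₂ : E d} (h₁ : ‖a₁‖ ≤ 1)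
    (h₂ : ‖a₂‖ ≤ 1) {q : E₂ d} {t₁ t₂ t₃ : ℝ} (ht₁ : |t₁| ≤ 6) (ht₂ : |t₂| ≤ 6) (ht₃ : |t₃| ≤ 6)
    (e₁ : a₁ = t₁ • shear P.c q) (e₂ : a₂ = t₂ • shear P.c q + t₃ • q.snd) :
    ((large h).W P q ^ (2 * d))⁻¹ * ((small h).W P q ^ d)⁻¹ ≤
      5184 ^ d * (cap P.b {i₀, i₁}ᶜ P.s₁ a₁ * cap P.b {i₀, i₁}ᶜ P.s₂ a₂) := by
  set J : Finset (Fin d) := {i₀, i₁}ᶜ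
  rw [cap, cap, Set.indicator_of_mem (by simpa using h₁), Set.indicator_of_mem (by simpa using h₂)]
  set S₁ : ℝ := ∑ k ∈ J, (inner ℝ (P.b k) (shear P.c q)) ^ 2 with hS₁
  set S₂ : ℝ := ∑ k ∈ J, (inner ℝ (P.b k) q.snd) ^ 2 with hS₂
  have hW1 : (large h).W P q = 1 + P.s₁ * S₁ := rfl
  have hW2 : (small h).W P q = 1 + P.s₂ * S₂ := rfl
  have hS₁0 : 0 ≤ S₁ := Finset.sum_nonneg fun k _ => sq_nonneg _
  have hS₂0 : 0 ≤ S₂ := Finset.sum_nonneg fun k _ => sq_nonneg _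
  have hs1 := P.s₁_nonneg
  have hs2 := P.s₂_nonneg
  have h12 := P.s₂_le
  have g1 : ∑ k ∈ J, (inner ℝ (P.b k) a₁) ^ 2 ≤ 72 * S₁ := by
    have := sum_inner_sq_add_le P.b J ht₁ (t₃ := 0) (by norm_num) (shear P.c q) 0
    simpa [← e₁] using this
  have g2 : ∑ k ∈ J, (inner ℝ (P.b k) a₂) ^ 2 ≤ 72 * (S₁ + S₂) := by
    rw [e₂]
    exact sum_inner_sq_add_le P.b J ht₂ ht₃ _ _
  have o1 := one_le_one_add (b := P.b) (J := J) hs1 a₁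
  have o2 := one_le_one_add (b := P.b) (J := J) hs2 a₂
  set A₁ : ℝ := 1 + P.s₁ * ∑ k ∈ J, (inner ℝ (P.b k) a₁) ^ 2
  set A₂ : ℝ := 1 + P.s₂ * ∑ k ∈ J, (inner ℝ (P.b k) a₂) ^ 2
  have w1 : 1 ≤ (large h).W P q := (large h).one_le_W P q
  have w2 : 1 ≤ (small h).W P q := (small h).one_le_W P q
  have k1 : A₁ ≤ 72 * (large h).W P q := by
    have := mul_le_mul_of_nonneg_left g1 hs1
    rw [hW1]
    linarith
  have k2 : A₂ ≤ 72 * ((large h).W P q * (small h).W P q) := by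
    have r1 := mul_le_mul_of_nonneg_left g2 hs2
    have r2 := mul_le_mul_of_nonneg_right h12 hS₁0
    have r3 : 0 ≤ P.s₁ * S₁ * (P.s₂ * S₂) := by positivity
    rw [hW1, hW2]
    linarith
  have k3 : A₁ * A₂ ≤ 5184 * ((large h).W P q ^ 2 * (small h).W P q) := by
    calc A₁ * A₂ ≤ (72 * (large h).W P q) * (72 * ((large h).W P q * (small h).W P q)) := by
          gcongr
      _ = _ := by ring
  have k4 := pow_le_pow_left₀ (by positivity) k3 d
  rw [← mul_inv, ← mul_inv, ← div_eq_mul_inv, inv_eq_one_div, div_le_div_iff₀ (by positivity)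
    (by positivity), one_mul, ← mul_pow, pow_mul, ← mul_pow, ← mul_pow]
  exact k4

/-- The weights concentrate near the critical set, a tube around it of radii `s₁ ^ (- 1 / 2)` and
`s₂ ^ (- 1 / 2)` in `d - 2` directions each. -/
lemma exists_integral_W_le (h : i₀ ≠ i₁) :
    ∃ K, 0 ≤ K ∧ ∀ P : PhaseData d,
      ∫ p, ((large h).W P p ^ (2 * d))⁻¹ * ((small h).W P p ^ d)⁻¹ ∂(surfaceMeasure d) ≤
        K * (((√(max 1 P.s₁)) ^ (d - 2))⁻¹ * ((√(max 1 P.s₂)) ^ (d - 2))⁻¹) := by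
  set B : Set (E d) := Metric.closedBall 0 1
  have hBm : MeasurableSet B := Metric.isClosed_closedBall.measurableSet
  have hV : volume (B ×ˢ B) = volume B * volume B := by
    rw [Measure.volume_eq_prod, Measure.prod_prod]
  have hV0 : volume (B ×ˢ B) ≠ 0 := by
    rw [hV]
    exact mul_ne_zero (Metric.measure_closedBall_pos volume _ one_pos).ne'
      (Metric.measure_closedBall_pos volume _ one_pos).ne'
  have hVt : volume (B ×ˢ B) ≠ ⊤ := by
    rw [hV]
    exact ENNReal.mul_ne_top measure_closedBall_lt_top.ne measure_closedBall_lt_top.ne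
  set v : ℝ := (volume (B ×ˢ B)).toReal
  have hv : 0 < v := ENNReal.toReal_pos hV0 hVt
  refine ⟨5184 ^ d * (4 ^ d * 4 ^ d) / v, by positivity, fun P => ?_⟩
  set J : Finset (Fin d) := {i₀, i₁}ᶜ with hJ
  have hcard : J.card = d - 2 := by
    rw [hJ, Finset.card_compl, Finset.card_pair h, Fintype.card_fin]
  set f : E₂ d → ℝ := fun p => ((large h).W P p ^ (2 * d))⁻¹ * ((small h).W P p ^ d)⁻¹
  have hf0 : ∀ p, 0 ≤ f p := fun p => mul_nonneg
    (inv_nonneg.mpr (pow_nonneg (zero_le_one.trans ((large h).one_le_W P p)) _))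
    (inv_nonneg.mpr (pow_nonneg (zero_le_one.trans ((small h).one_le_W P p)) _))
  have hfc : Continuous f := ((large h).continuous_inv_W_pow P _).mul
    ((small h).continuous_inv_W_pow P _)
  have key := volume_mul_lintegral_le (φ := fun p => ENNReal.ofReal (f p))
    (H := fun A => ENNReal.ofReal (5184 ^ d) *
      (ENNReal.ofReal (cap P.b J P.s₁ A.1) * ENNReal.ofReal (cap P.b J P.s₂ A.2)))
    hfc.measurable.ennreal_ofReal
    ((((measurable_cap _ _ _).comp measurable_fst).ennreal_ofReal.mul
      ((measurable_cap _ _ _).comp measurable_snd).ennreal_ofReal).const_mul _)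
    (hBm.prod hBm) (by
      rintro p hp ⟨a₁, a₂⟩ ⟨h₁, h₂⟩
      have h₁' : ‖a₁‖ ≤ 1 := by simpa [B] using h₁
      have h₂' : ‖a₂‖ ≤ 1 := by simpa [B] using h₂
      obtain ⟨g, t₁, t₂, t₃, ht₁, ht₂, ht₃, e₁, e₂⟩ :=
        exists_triangular h P.abs_c_le hp h₁' h₂'
      refine ⟨g, fun k => ?_⟩
      rw [← ENNReal.ofReal_mul (cap_nonneg P.s₁_nonneg _), ← ENNReal.ofReal_mul (by positivity)]
      refine ENNReal.ofReal_le_ofReal (inv_W_le_cap h P ?_ ?_ ht₁ ht₂ ht₃ ?_ ?_)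
      · rwa [Unitary.norm_map]
      · rwa [Unitary.norm_map]
      · rw [shear_diag, ← map_smul, ← e₁]
      · rw [shear_diag, diag_snd]
        exact (congrArg (k : E d →L[ℝ] E d) e₂).trans (by rw [map_add, map_smul, map_smul]))
  rw [← ofReal_integral_eq_lintegral_ofReal (integrable_of_continuous hfc) (.of_forall hf0),
    lintegral_const_mul' _ _ ENNReal.ofReal_ne_top, Measure.volume_eq_prod,
    lintegral_prod_mul (measurable_cap _ _ _).ennreal_ofReal.aemeasurable
      (measurable_cap _ _ _).ennreal_ofReal.aemeasurable, ← Measure.volume_eq_prod,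
    ← ENNReal.ofReal_toReal hVt] at key
  have hc1 := lintegral_cap_le P.b J P.s₁_nonneg
  have hc2 := lintegral_cap_le P.b J P.s₂_nonneg
  rw [hcard] at hc1 hc2
  have key2 := key.trans (mul_le_mul_right (mul_le_mul' hc1 hc2) (ENNReal.ofReal (5184 ^ d)))
  rw [← ENNReal.ofReal_mul hv.le, ← ENNReal.ofReal_mul (by positivity),
    ← ENNReal.ofReal_mul (by positivity), ENNReal.ofReal_le_ofReal_iff (by positivity)] at key2
  rw [div_mul_eq_mul_div, le_div_iff₀ hv, mul_comm]
  refine key2.trans (le_of_eq ?_)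
  ring

/-- The decay of oscillatory integrals over `M` with a fixed smooth amplitude. -/
lemma exists_decay (h : i₀ ≠ i₁) {a : E₂ d → ℂ} (ha : ContDiff ℝ ∞ a) :
    ∃ C, 0 ≤ C ∧ ∀ P : PhaseData d,
      ‖∫ p, cexp (-I * ((phase i₀ i₁ P p : ℝ) : ℂ)) * a p ∂(surfaceMeasure d)‖ ≤
        C * (((√(max 1 P.s₁)) ^ (d - 2))⁻¹ * ((√(max 1 P.s₂)) ^ (d - 2))⁻¹) := by
  obtain ⟨C, hC0, hC⟩ := exists_norm_integral_le h (2 * d) d ha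
  obtain ⟨K, hK0, hK⟩ := exists_integral_W_le h
  refine ⟨C * K, mul_nonneg hC0 hK0, fun P => (hC P).trans ?_⟩
  rw [mul_assoc]
  exact mul_le_mul_of_nonneg_left (hK P) hC0

end PhaseData

end Decay

/-! ### The Fourier transform and its derivatives -/

section Fourier

open MeasureTheory Complex

open scoped FourierTransform

variable {d : ℕ}

/-- The pairing `((u, v), (ξ, η)) ↦ ξ · u + η · v`. -/
def pairing (d : ℕ) : E₂ d →L[ℝ] (E d × E d) →L[ℝ] ℝ :=
  (ContinuousLinearMap.precomp ℝ (ContinuousLinearMap.fst ℝ (E d) (E d))) ∘L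
      (innerSL ℝ : E d →L[ℝ] E d →L[ℝ] ℝ) ∘L (WithLp.fstL 2 ℝ (E d) (E d)) +
    (ContinuousLinearMap.precomp ℝ (ContinuousLinearMap.snd ℝ (E d) (E d))) ∘L
      (innerSL ℝ : E d →L[ℝ] E d →L[ℝ] ℝ) ∘L (WithLp.sndL 2 ℝ (E d) (E d))

lemma pairing_apply (p : E₂ d) (ζ : E d × E d) :
    pairing d p ζ = inner ℝ ζ.1 p.fst + inner ℝ ζ.2 p.snd := by
  rw [real_inner_comm, real_inner_comm p.snd]
  rfl

/-- The Fourier transform of the measure with density `a` with respect to the surface measure. -/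
def muHatWith (a : E₂ d → ℂ) (ζ : E d × E d) : ℂ :=
  VectorFourier.fourierIntegral 𝐞 (surfaceMeasure d) (pairing d).toLinearMap₁₂ a ζ

lemma muHatWith_eq (a : E₂ d → ℂ) (ζ : E d × E d) :
    muHatWith a ζ = ∫ p : E₂ d, cexp
      (-2 * (Real.pi : ℂ) * I * ((inner ℝ ζ.1 p.fst + inner ℝ ζ.2 p.snd : ℝ) : ℂ)) * a p
      ∂(surfaceMeasure d) := by
  unfold muHatWith VectorFourier.fourierIntegral
  refine integral_congr_ae (.of_forall fun p => ?_)
  show 𝐞 (-(pairing d p ζ)) • a p = _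
  rw [pairing_apply, Circle.smul_def, Real.fourierChar_apply, smul_eq_mul]
  congr 2
  push_cast
  ring

lemma muHat_eq_muHatWith_one : muHat d = muHatWith (fun _ => 1) := by
  ext ζ
  rw [muHatWith_eq]
  simp only [mul_one]
  rfl

lemma contDiff_muHatWith {a : E₂ d → ℂ} (ha : Continuous a) : ContDiff ℝ ∞ (muHatWith a) :=
  VectorFourier.contDiff_fourierIntegral (N := ⊤) (pairing d)
    fun n _ => integrable_of_continuous ((continuous_norm.pow n).mul ha.norm)

lemma lineDeriv_muHatWith {a : E₂ d → ℂ} (ha : Continuous a) (ζ w : E d × E d) :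
    lineDeriv ℝ (muHatWith a) ζ w =
      muHatWith (fun p => -(2 * Real.pi * I) * ((pairing d p w : ℝ) : ℂ) * a p) ζ := by
  have h1 : DifferentiableAt ℝ (muHatWith a) ζ :=
    ((contDiff_muHatWith ha).differentiable (by simp)).differentiableAt
  have hc : Continuous (VectorFourier.fourierSMulRight (pairing d) a) := by
    unfold VectorFourier.fourierSMulRight
    have h0 : Continuous fun z : ((E d × E d) →L[ℝ] ℝ) × ℂ => z.1.smulRight z.2 :=
      (ContinuousLinearMap.smulRightL ℝ (E d × E d) ℂ).continuous₂
    exact (h0.comp ((pairing d).continuous.prodMk ha)).const_smul (-(2 * Real.pi * I) : ℂ)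
  rw [h1.lineDeriv_eq_fderiv]
  have h2 := VectorFourier.fderiv_fourierIntegral (pairing d) (μ := surfaceMeasure d) (f := a)
    (integrable_of_continuous ha) (integrable_of_continuous (continuous_norm.mul ha.norm))
  have h3 : fderiv ℝ (muHatWith a) ζ = VectorFourier.fourierIntegral 𝐞 (surfaceMeasure d)
    (pairing d).toLinearMap₁₂ (VectorFourier.fourierSMulRight (pairing d) a) ζ := congrFun h2 ζ
  rw [h3, VectorFourier.fourierIntegral_continuousLinearMap_apply Real.continuous_fourierChar
    (integrable_of_continuous hc)]
  unfold muHatWith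
  congr 1
  ext p
  rw [VectorFourier.fourierSMulRight_apply]
  simp only [smul_eq_mul, real_smul]
  ring

/-- The Fourier transforms of the measures with smooth densities with respect to the surface
measure. -/
def SmoothTransform (F : E d × E d → ℂ) : Prop :=
  ∃ a : E₂ d → ℂ, ContDiff ℝ ∞ a ∧ F = muHatWith a

lemma SmoothTransform.lineDeriv {F : E d × E d → ℂ} (hF : SmoothTransform F) (w : E d × E d) :
    SmoothTransform (fun ζ => lineDeriv ℝ F ζ w) := by
  obtain ⟨a, ha, rfl⟩ := hF
  refine ⟨fun p => -(2 * Real.pi * I) * ((pairing d p w : ℝ) : ℂ) * a p, ?_, ?_⟩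
  · refine (contDiff_const.mul (ofRealCLM.contDiff.comp ?_)).mul ha
    exact (ContinuousLinearMap.apply ℝ ℝ w).contDiff.comp (pairing d).contDiff
  · ext ζ
    exact lineDeriv_muHatWith ha.continuous ζ w

lemma SmoothTransform.foldr {T : Fin d → (E d × E d → ℂ) → (E d × E d → ℂ)}
    (hT : ∀ i F, SmoothTransform F → SmoothTransform (T i F)) (α : Fin d → ℕ) (l : List (Fin d))
    {F : E d × E d → ℂ} (hF : SmoothTransform F) :
    SmoothTransform (l.foldr (fun i G => (T i)^[α i] G) F) := by
  have hit : ∀ i n G, SmoothTransform G → SmoothTransform ((T i)^[n] G) := by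
    intro i n
    induction n with
    | zero => exact fun G hG => hG
    | succ n ih => exact fun G hG => ih _ (hT i G hG)
  induction l with
  | nil => exact hF
  | cons i l ih => exact hit i _ _ ih

lemma SmoothTransform.multiXi {F : E d × E d → ℂ} (hF : SmoothTransform F) (α : Fin d → ℕ) :
    SmoothTransform (multiXi α F) :=
  SmoothTransform.foldr (fun i _ hG => hG.lineDeriv (EuclideanSpace.single i 1, 0)) α _ hF

lemma SmoothTransform.multiEta {F : E d × E d → ℂ} (hF : SmoothTransform F) (β : Fin d → ℕ) :
    SmoothTransform (multiEta β F) :=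
  SmoothTransform.foldr (fun i _ hG => hG.lineDeriv (0, EuclideanSpace.single i 1)) β _ hF

lemma muHatWith_swap {a : E₂ d → ℂ} (ha : Continuous a) (ξ η : E d) :
    muHatWith a (ξ, η) =
      muHatWith (a ∘ LinearIsometryEquiv.withLpProdComm 2 ℝ (E d) (E d)) (η, ξ) := by
  rw [muHatWith_eq, muHatWith_eq]
  set σ := LinearIsometryEquiv.withLpProdComm 2 ℝ (E d) (E d)
  have h := measurePreserving_swap d
  have hc : Continuous fun p : E₂ d => cexp
      (-2 * (Real.pi : ℂ) * I * ((inner ℝ ξ p.fst + inner ℝ η p.snd : ℝ) : ℂ)) * a p := by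
    refine Continuous.mul (continuous_exp.comp (continuous_const.mul
      (continuous_ofReal.comp ?_))) ha
    exact ((innerSL ℝ ξ).continuous.comp (WithLp.fstL 2 ℝ (E d) (E d)).continuous).add
      ((innerSL ℝ η).continuous.comp (WithLp.sndL 2 ℝ (E d) (E d)).continuous)
  have h2 := integral_map (μ := surfaceMeasure d) h.measurable.aemeasurable
    hc.aestronglyMeasurable
  rw [h.map_eq] at h2
  rw [h2]
  refine integral_congr_ae (.of_forall fun p => ?_)
  show cexp (-2 * (Real.pi : ℂ) * I * ((inner ℝ ξ p.snd + inner ℝ η p.fst : ℝ) : ℂ)) * a (σ p) =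
    cexp (-2 * (Real.pi : ℂ) * I * ((inner ℝ η p.fst + inner ℝ ξ p.snd : ℝ) : ℂ)) * a (σ p)
  rw [add_comm (inner ℝ ξ p.snd)]

lemma inv_sqrt_pow_le {m x : ℝ} {d : ℕ} (hd : 2 ≤ d) (hx : 0 ≤ x) (hm : 1 + x ≤ 4 * m) :
    ((√m) ^ (d - 2))⁻¹ ≤ 4 ^ (((d : ℝ) - 2) / 2) * (1 + x) ^ (-(((d : ℝ) - 2) / 2)) := by
  have hm0 : 0 < m := by linarith
  have hk : 0 ≤ ((d : ℝ) - 2) / 2 := by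
    have : (2 : ℝ) ≤ d := by exact_mod_cast hd
    linarith
  have h1 : (√m) ^ (d - 2) = m ^ (((d : ℝ) - 2) / 2) := by
    rw [Real.sqrt_eq_rpow, ← Real.rpow_natCast, ← Real.rpow_mul hm0.le]
    congr 1
    push_cast [Nat.cast_sub hd]
    ring
  rw [h1, Real.rpow_neg (by linarith), ← div_eq_mul_inv, inv_eq_one_div,
    div_le_div_iff₀ (by positivity) (by positivity), one_mul, ← Real.mul_rpow (by norm_num) hm0.le]
  exact Real.rpow_le_rpow (by linarith) hm hk

/-- Adapted coordinates for a pair of frequencies: the phase `2 π (ξ · u + η · v)` is of the form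
`s₁ ⟨b i₀, u + c v⟩ + s₂ ⟨b i₁, v⟩`. -/
lemma exists_phaseData {i₀ i₁ : Fin d} (h : i₀ ≠ i₁) {ξ η : E d} (hle : ‖η‖ ≤ ‖ξ‖) :
    ∃ P : PhaseData d, P.s₁ = 2 * Real.pi * ‖ξ‖ ∧
      P.s₂ = 2 * Real.pi * (‖η‖ * |Real.sin (InnerProductGeometry.angle ξ η)|) ∧
      ∀ p, PhaseData.phase i₀ i₁ P p = 2 * Real.pi * (inner ℝ ξ p.fst + inner ℝ η p.snd) := by
  obtain ⟨b, β, γ, hγ, hξ, hη⟩ := exists_frame h ξ η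
  have hP := orthonormal_iff_ite.mp b.orthonormal
  have hn : ‖η‖ ^ 2 = β ^ 2 + γ ^ 2 := by
    rw [← real_inner_self_eq_norm_sq, hη]
    simp only [inner_add_left, inner_add_right, real_inner_smul_left, real_inner_smul_right, hP,
      if_neg h, if_neg h.symm, if_true]
    ring
  have hi : inner ℝ ξ η = ‖ξ‖ * β := by
    rw [hη]
    nth_rewrite 1 [hξ]
    simp only [inner_add_right, real_inner_smul_left, real_inner_smul_right, hP,
      if_neg h, if_true]
    ring
  have hβ : |β| ≤ ‖ξ‖ := by
    refine (abs_le_of_sq_le_sq ?_ (norm_nonneg η)).trans hle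
    nlinarith [sq_nonneg γ]
  have hγη : γ ≤ ‖ξ‖ := by
    refine (le_of_sq_le_sq ?_ (norm_nonneg η)).trans hle
    nlinarith [sq_nonneg β]
  have hsin : γ = ‖η‖ * |Real.sin (InnerProductGeometry.angle ξ η)| := by
    refine (sq_eq_sq₀ hγ (by positivity)).mp ?_
    rw [mul_pow, sq_abs, Real.sin_sq, mul_sub, mul_one]
    by_cases h0 : ‖ξ‖ = 0
    · have : ‖η‖ = 0 := le_antisymm (h0 ▸ hle) (norm_nonneg _)
      rw [this] at hn ⊢
      nlinarith [sq_nonneg β, sq_nonneg γ]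
    · have hcos := InnerProductGeometry.cos_angle_mul_norm_mul_norm ξ η
      rw [hi] at hcos
      have : ‖η‖ * Real.cos (InnerProductGeometry.angle ξ η) = β := by
        refine mul_left_cancel₀ h0 ?_
        linarith
      rw [← mul_pow, this]
      linarith
  have hcβ : ‖ξ‖ * (β / ‖ξ‖) = β := by
    by_cases h0 : ‖ξ‖ = 0
    · rw [h0] at hβ ⊢
      rw [zero_mul, abs_nonpos_iff.mp hβ]
    · field_simp
  refine ⟨⟨b, β / ‖ξ‖, 2 * Real.pi * ‖ξ‖, 2 * Real.pi * γ, ?_, by positivity, by gcongr⟩, rfl,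
    by rw [← hsin], fun p => ?_⟩
  · rw [abs_div, abs_norm]
    exact div_le_one_of_le₀ hβ (norm_nonneg _)
  · have e1 : (inner ℝ ξ p.fst : ℝ) = ‖ξ‖ * inner ℝ (b i₀) p.fst := by
      nth_rewrite 1 [hξ]
      rw [real_inner_smul_left]
    rw [PhaseData.phase_apply, e1, hη, inner_add_left, inner_add_right, real_inner_smul_left,
      real_inner_smul_left, real_inner_smul_right]
    linear_combination (2 * Real.pi * inner ℝ (b i₀) p.snd) * hcβ

lemma exists_muHatWith_bound_of_le (hd : 3 ≤ d) {a : E₂ d → ℂ} (ha : ContDiff ℝ ∞ a) :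
    ∃ C, 0 ≤ C ∧ ∀ ξ η : E d, ‖η‖ ≤ ‖ξ‖ → ‖muHatWith a (ξ, η)‖ ≤
      C * (1 + min ‖ξ‖ ‖η‖ * |Real.sin (InnerProductGeometry.angle ξ η)|)
            ^ (-(((d : ℝ) - 2) / 2))
        * (1 + √(‖ξ‖ ^ 2 + ‖η‖ ^ 2)) ^ (-(((d : ℝ) - 2) / 2)) := by
  obtain ⟨i₀, i₁, h⟩ : ∃ i₀ i₁ : Fin d, i₀ ≠ i₁ :=
    ⟨⟨0, by omega⟩, ⟨1, by omega⟩, by simp⟩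
  obtain ⟨C, hC0, hC⟩ := PhaseData.exists_decay h ha
  refine ⟨C * (4 ^ (((d : ℝ) - 2) / 2) * 4 ^ (((d : ℝ) - 2) / 2)), by positivity,
    fun ξ η hle => ?_⟩
  obtain ⟨P, hs₁, hs₂, hph⟩ := exists_phaseData h hle
  have e1 : muHatWith a (ξ, η) = ∫ p, cexp (-I * ((PhaseData.phase i₀ i₁ P p : ℝ) : ℂ)) * a p
      ∂(surfaceMeasure d) := by
    rw [muHatWith_eq]
    refine integral_congr_ae (.of_forall fun p => ?_)
    simp only [hph]
    congr 2
    push_cast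
    ring
  rw [e1, min_eq_right hle]
  refine (hC P).trans ?_
  set γ : ℝ := ‖η‖ * |Real.sin (InnerProductGeometry.angle ξ η)|
  have hγ : 0 ≤ γ := by positivity
  have hπ := Real.pi_gt_three
  have b2 := inv_sqrt_pow_le (m := max 1 P.s₂) (x := γ) (d := d) (by omega) hγ (by
    have := le_max_left 1 P.s₂
    have h2 := le_max_right 1 P.s₂
    rw [hs₂] at h2 this ⊢
    nlinarith)
  have hr : √(‖ξ‖ ^ 2 + ‖η‖ ^ 2) ≤ 2 * ‖ξ‖ := by
    refine Real.sqrt_le_iff.mpr ⟨by positivity, ?_⟩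
    nlinarith [norm_nonneg ξ, norm_nonneg η]
  have b1 := inv_sqrt_pow_le (m := max 1 P.s₁) (x := √(‖ξ‖ ^ 2 + ‖η‖ ^ 2)) (d := d) (by omega)
    (Real.sqrt_nonneg _) (by
    have := le_max_left 1 P.s₁
    have h2 := le_max_right 1 P.s₁
    rw [hs₁] at h2 this ⊢
    nlinarith [norm_nonneg ξ])
  calc C * (((√(max 1 P.s₁)) ^ (d - 2))⁻¹ * ((√(max 1 P.s₂)) ^ (d - 2))⁻¹)
      ≤ C * ((4 ^ (((d : ℝ) - 2) / 2) * (1 + √(‖ξ‖ ^ 2 + ‖η‖ ^ 2)) ^ (-(((d : ℝ) - 2) / 2))) *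
          (4 ^ (((d : ℝ) - 2) / 2) * (1 + γ) ^ (-(((d : ℝ) - 2) / 2)))) := by gcongr
    _ = _ := by ring

/-- The decay estimate for all frequencies, by symmetry in `u` and `v`. -/
lemma exists_muHatWith_bound (hd : 3 ≤ d) {a : E₂ d → ℂ} (ha : ContDiff ℝ ∞ a) :
    ∃ C, ∀ ξ η : E d, ‖muHatWith a (ξ, η)‖ ≤
      C * (1 + min ‖ξ‖ ‖η‖ * |Real.sin (InnerProductGeometry.angle ξ η)|)
            ^ (-(((d : ℝ) - 2) / 2))
        * (1 + √(‖ξ‖ ^ 2 + ‖η‖ ^ 2)) ^ (-(((d : ℝ) - 2) / 2)) := by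
  obtain ⟨C₁, h₁0, h₁⟩ := exists_muHatWith_bound_of_le hd ha
  obtain ⟨C₂, h₂0, h₂⟩ := exists_muHatWith_bound_of_le hd
    (ha.comp (LinearIsometryEquiv.withLpProdComm 2 ℝ (E d) (E d)).contDiff)
  refine ⟨C₁ + C₂, fun ξ η => ?_⟩
  have hmin : 0 ≤ min ‖ξ‖ ‖η‖ := le_min (norm_nonneg _) (norm_nonneg _)
  rcases le_total ‖η‖ ‖ξ‖ with hle | hle
  · refine (h₁ ξ η hle).trans ?_
    gcongr
    linarith
  · rw [muHatWith_swap ha.continuous]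
    refine (h₂ η ξ hle).trans ?_
    rw [min_comm, InnerProductGeometry.angle_comm, add_comm (‖η‖ ^ 2)]
    gcongr
    linarith

end Fourier

end TriangleAveraging

end

theorem mainTheorem2 (d : ℕ) (hd : 3 ≤ d) :
    ContDiff ℝ ∞ (TriangleAveraging.muHat d) ∧
    ∀ α β : Fin d → ℕ, ∃ C : ℝ, ∀ ξ η : EuclideanSpace ℝ (Fin d),
      ‖TriangleAveraging.multiXi α
          (TriangleAveraging.multiEta β (TriangleAveraging.muHat d)) (ξ, η)‖ ≤
        C * (1 + min ‖ξ‖ ‖η‖ * |Real.sin (InnerProductGeometry.angle ξ η)|)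
              ^ (-(((d : ℝ) - 2) / 2))
          * (1 + Real.sqrt (‖ξ‖ ^ 2 + ‖η‖ ^ 2)) ^ (-(((d : ℝ) - 2) / 2)) := by
  rw [TriangleAveraging.muHat_eq_muHatWith_one]
  refine ⟨TriangleAveraging.contDiff_muHatWith continuous_const, fun α β => ?_⟩
  have h : TriangleAveraging.SmoothTransform
      (TriangleAveraging.muHatWith (d := d) fun _ => 1) := ⟨_, contDiff_const, rfl⟩
  obtain ⟨a, ha, hF⟩ := (h.multiEta β).multiXi α
  rw [hF]
  exact TriangleAveraging.exists_muHatWith_bound hd ha
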